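/- Let $G=(S,E)$ be a finite simple graph. Let $V$ be the $\mathbb{Q}$-vector space with basis $S$, let $W\subseteq \wedge^2 V$ be the subspace spanned by the vectors $\eta\wedge\zeta$ with $\eta,\zeta\in S$ and $\eta\zeta\in E$, and let $\mathcal{N}_{\mathbb{Q}}=V\oplus W$ be the rational 2-step nilpotent Lie algebra of $G$, with the unique bilinear bracket such that, for vertices $\eta,\zeta\in S$, $[\eta,\zeta]=\eta\wedge\zeta$ if $\eta\zeta\in E$ and $[\eta,\zeta]=0$ otherwise, and $[\mathcal{N}_{\mathbb{Q}},W]=[W,\mathcal{N}_{\mathbb{Q}}]=0$. Let $\alpha,\beta,\gamma,\delta\in S$ be distinct vertices such that $\alpha\beta,\gamma\delta,\alpha\gamma,\alpha\delta\in E$, let $X=[\alpha,\beta]+[\gamma,\delta]$, and let $\mathcal{H}_{\mathbb{Q}}=\mathcal{N}_{\mathbb{Q}}/\langle X\rangle$ be the quotient by the one-dimensional subspace (an ideal) spanned by $X$. Then $\mathcal{H}_{\mathbb{Q}}$ has no Lie algebra automorphism that is hyperbolic (all of its complex eigenvalues have modulus different from $1$) and whose characteristic polynomial has integer coefficients and constant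 term $\pm 1$. -/

import Mathlib

namespace GraphLie

open scoped BigOperators

variable {S : Type*} [Fintype S] [DecidableEq S]

/-- The vector `a ∧ b` of the second exterior power of the rational vector space with basis `S`,
where a vertex `a` is the basis vector `Pi.single a 1`. -/
noncomputable def wedge (a b : S) : ⋀[ℚ]^2 (S → ℚ) :=
  exteriorPower.ιMulti ℚ 2 ![Pi.single a 1, Pi.single b 1]

theorem wedge_swap {S : Type*} [DecidableEq S] (a b : S) : wedge b a + wedge a b = 0 := by
  have h := (exteriorPower.ιMulti ℚ 2 (M := S → ℚ)).map_add_swap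
    ![Pi.single a 1, Pi.single b 1] (i := 0) (j := 1) (by decide)
  rw [add_comm] at h
  unfold wedge
  rw [← h]
  congr 2
  ext i
  fin_cases i <;> rfl

/-- The subspace `W` of the second exterior power spanned by the `a ∧ b` with `ab` an edge. -/
noncomputable def edgeSpace (G : SimpleGraph S) : Submodule ℚ (⋀[ℚ]^2 (S → ℚ)) :=
  Submodule.span ℚ {w | ∃ a b, G.Adj a b ∧ w = wedge a b}

open Classical in
/-- `a ∧ b` if `ab` is an edge, and `0` otherwise. -/
noncomputable def edgeVec (G : SimpleGraph S) (a b : S) : edgeSpace G :=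
  if h : G.Adj a b then ⟨wedge a b, Submodule.subset_span ⟨a, b, h, rfl⟩⟩ else 0

theorem edgeVec_swap {S : Type*} [DecidableEq S] (G : SimpleGraph S) (a b : S) : edgeVec G b a + edgeVec G a b = 0 := by
  unfold edgeVec
  by_cases h : G.Adj a b
  · rw [dif_pos h, dif_pos h.symm]
    exact Subtype.ext (wedge_swap a b)
  · rw [dif_neg h, dif_neg (fun h2 => h h2.symm), add_zero]

/-- The bilinear map `V × V → W` sending a pair of vertices `(a, b)` to `a ∧ b` if `ab` is an edge
and to `0` otherwise. -/
noncomputable def edgeBracket (G : SimpleGraph S) (v v' : S → ℚ) : edgeSpace G :=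
  ∑ a, ∑ b, (v a * v' b) • edgeVec G a b

/-- The underlying space `V ⊕ W` of the rational 2-step nilpotent Lie algebra of the graph `G`. -/
def NilLie (G : SimpleGraph S) : Type _ := (S → ℚ) × edgeSpace G

variable (G : SimpleGraph S)

noncomputable instance : AddCommGroup (NilLie G) :=
  inferInstanceAs (AddCommGroup ((S → ℚ) × edgeSpace G))

noncomputable instance : Module ℚ (NilLie G) :=
  inferInstanceAs (Module ℚ ((S → ℚ) × edgeSpace G))

instance : Module.Finite ℚ (NilLie G) :=
  inferInstanceAs (Module.Finite ℚ ((S → ℚ) × edgeSpace G))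

/-- `[v + w, v' + w'] = [v, v']` for `v, v'` in `V` and `w, w'` in `W`. -/
noncomputable instance : Bracket (NilLie G) (NilLie G) :=
  ⟨fun x y => ((0 : S → ℚ), edgeBracket G x.1 y.1)⟩

theorem lie_def (x y : NilLie G) : ⁅x, y⁆ = ((0 : S → ℚ), edgeBracket G x.1 y.1) := rfl

theorem edgeBracket_zero_left (v : S → ℚ) : edgeBracket G 0 v = 0 := by
  simp [edgeBracket]

theorem edgeBracket_zero_right (v : S → ℚ) : edgeBracket G v 0 = 0 := by
  simp [edgeBracket]

theorem edgeBracket_self (v : S → ℚ) : edgeBracket G v v = 0 := by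
  have h : edgeBracket G v v = ∑ a, ∑ b, (v a * v b) • edgeVec G b a := by
    unfold edgeBracket
    rw [Finset.sum_comm]
    refine Finset.sum_congr rfl fun a _ => Finset.sum_congr rfl fun b _ => ?_
    rw [mul_comm]
  have h2 : (2 : ℚ) • edgeBracket G v v = 0 := by
    rw [two_smul]
    nth_rewrite 1 [h]
    unfold edgeBracket
    rw [← Finset.sum_add_distrib]
    refine Finset.sum_eq_zero fun a _ => ?_
    rw [← Finset.sum_add_distrib]
    refine Finset.sum_eq_zero fun b _ => ?_
    rw [← smul_add, edgeVec_swap, smul_zero]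
  exact (smul_eq_zero.mp h2).resolve_left two_ne_zero

noncomputable instance : LieRing (NilLie G) where
  add_lie x y z := Prod.ext (add_zero (0 : S → ℚ)).symm (by
    change edgeBracket G (x.1 + y.1) z.1 = edgeBracket G x.1 z.1 + edgeBracket G y.1 z.1
    simp [edgeBracket, add_mul, add_smul, Finset.sum_add_distrib])
  lie_add x y z := Prod.ext (add_zero (0 : S → ℚ)).symm (by
    change edgeBracket G x.1 (y.1 + z.1) = edgeBracket G x.1 y.1 + edgeBracket G x.1 z.1
    simp [edgeBracket, mul_add, add_smul, Finset.sum_add_distrib])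
  lie_self x := Prod.ext rfl (edgeBracket_self G x.1)
  leibniz_lie x y z := Prod.ext (add_zero (0 : S → ℚ)).symm (by
    change edgeBracket G x.1 0 = edgeBracket G 0 z.1 + edgeBracket G y.1 0
    simp [edgeBracket_zero_left, edgeBracket_zero_right])

noncomputable instance : LieAlgebra ℚ (NilLie G) where
  lie_smul t x y := Prod.ext (smul_zero t).symm (by
    change edgeBracket G x.1 (t • y.1) = t • edgeBracket G x.1 y.1
    simp only [edgeBracket, Finset.smul_sum, smul_smul, Pi.smul_apply, smul_eq_mul]
    refine Finset.sum_congr rfl fun a _ => Finset.sum_congr rfl fun b _ => ?_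
    congr 1
    ring)

/-- A vertex as an element of the Lie algebra. -/
noncomputable def vertex (a : S) : NilLie G := (Pi.single a 1, (0 : edgeSpace G))

/-- `[a, b] = a ∧ b` for an edge `ab` and `[a, b] = 0` for a non-edge. -/
theorem vertex_lie_vertex (a b : S) :
    ⁅vertex G a, vertex G b⁆ = ((0 : S → ℚ), edgeVec G a b) := by
  refine Prod.ext rfl ?_
  change edgeBracket G (Pi.single a 1) (Pi.single b 1) = edgeVec G a b
  unfold edgeBracket
  rw [Finset.sum_eq_single a, Finset.sum_eq_single b]
  · simp
  · intro c _ hc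
    simp [hc]
  · simp
  · intro c _ hc
    simp [hc]
  · simp

theorem lie_lie_eq_zero (x y z : NilLie G) : ⁅x, ⁅y, z⁆⁆ = 0 :=
  Prod.ext rfl (edgeBracket_zero_right G x.1)

/-- The element `[α, β] + [γ, δ]`. -/
noncomputable def quotElt (α β γ δ : S) : NilLie G :=
  ⁅vertex G α, vertex G β⁆ + ⁅vertex G γ, vertex G δ⁆

/-- The subspace spanned by `[α, β] + [γ, δ]`, which is an ideal. -/
noncomputable def quotIdeal (α β γ δ : S) : LieIdeal ℚ (NilLie G) where
  toSubmodule := Submodule.span ℚ {quotElt G α β γ δ}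
  lie_mem {x m} hm := by
    obtain ⟨c, rfl⟩ := Submodule.mem_span_singleton.mp hm
    have h : ⁅x, c • quotElt G α β γ δ⁆ = 0 := by
      rw [lie_smul, quotElt, lie_add, lie_lie_eq_zero, lie_lie_eq_zero, add_zero, smul_zero]
    rw [h]
    exact Submodule.zero_mem _

/-- The quotient of the rational 2-step nilpotent Lie algebra of the graph by the subspace spanned
by `[α, β] + [γ, δ]`. -/
abbrev QuotLie (α β γ δ : S) : Type _ := NilLie G ⧸ quotIdeal G α β γ δ

instance (α β γ δ : S) : Module.Finite ℚ (QuotLie G α β γ δ) :=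
  Module.Finite.of_surjective
    (LieSubmodule.Quotient.mk' (quotIdeal G α β γ δ)).toLinearMap
    (LieSubmodule.Quotient.surjective_mk' _)

/-- All complex eigenvalues of the rational linear map `f` have modulus different from `1`. -/
def IsHyperbolic {M : Type*} [AddCommGroup M] [Module ℚ M] (f : M →ₗ[ℚ] M) : Prop :=
  ∀ z : ℂ, Module.End.HasEigenvalue (f.baseChange ℂ) z → ‖z‖ ≠ 1

/-- The characteristic polynomial of `f` has integer coefficients and constant term a unit
of `ℤ`. -/
def HasIntegralUnitCharpoly {M : Type*} [AddCommGroup M] [Module ℚ M] [Module.Finite ℚ M]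
    (f : M →ₗ[ℚ] M) : Prop :=
  ∃ p : Polynomial ℤ, p.map (Int.castRingHom ℚ) = f.charpoly ∧ IsUnit (p.coeff 0)

end GraphLie

/-! Write `[u, v]` for the graph bracket on `V`. An automorphism `σ` of the quotient preserves the
image of `W`, which is spanned by brackets, so it induces an automorphism `f` of `V`. By a Plücker
relation at the edges `αβ, γδ, αγ, αδ`, no nonzero multiple of `X` is a single bracket; hence `f`
preserves the relation `[u, v] = 0`, although `σ` need not lift to the graph algebra a priori.

Preservation of commutation makes some power `M = f ^ k` triangular for the domination preorder, `s
≤ t` iff every neighbour of `s` other than `t` is a neighbour of `t` (`exists_pow_isTri`): the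
maximal subspaces on which centralisers have dimension at least `m` are coordinate subspaces, so
there are finitely many and `f` permutes them.

Hyperbolicity and integrality enter only through `not_eigen_mod`: `σ ^ k` has no rational eigenvalue
on an invariant subquotient, because an eigenvalue of `σ` with a rational power is a unit algebraic
integer, hence of modulus one.

The triangular `M` induces a map `F` on edge coordinates by `[u, v] ↦ [M u, M v]` and a derivation
`D` by `[u, v] ↦ [M u, v] + [u, M v]`. They commute on brackets and `F X = c X`, so the image of `D
X` in the quotient satisfies the eigenvector equation for the rational number `c`; therefore it
vanishes and `D X = μ X`. Comparing coordinates in `F X = c X` and `D X = μ X` leaves so little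
freedom in `M` that, modulo lower terms, either some `[M α, α]` or `[α, β]` (up to exchanging roles)
satisfies the eigenvector equation for `c` without being a multiple of `X`, a contradiction
(`Config.elim`). -/

namespace GraphLie

/-! ### Arithmetic of rational eigenvalues of powers -/

/-- A unit algebraic integer with a rational positive power has modulus one. -/
theorem norm_eq_one_of_pow_eq_rat {p : Polynomial ℤ} (hp : p.Monic) (h0 : IsUnit (p.coeff 0))
    {z : ℂ} (hz : Polynomial.aeval z p = 0) {k : ℕ} (hk : k ≠ 0) {q : ℚ} (hq : z ^ k = q) :
    ‖z‖ = 1 := by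
  have hint : IsIntegral ℤ z := ⟨p, hp, hz⟩
  obtain ⟨w, hw, hzw⟩ : ∃ w : ℂ, IsIntegral ℤ w ∧ z * w = 1 := by
    -- From `p = X * divX p + p(0)` with `p(0) = ±1`, the inverse of `z` is, up to sign, a
    -- polynomial in `z`, hence integral. Then `q` and `q⁻¹` are both rational integers.
    have h1 := congrArg (Polynomial.aeval z) (Polynomial.X_mul_divX_add p)
    rw [map_add, map_mul, Polynomial.aeval_X, Polynomial.aeval_C, hz] at h1
    have h2 : IsIntegral ℤ (Polynomial.aeval z p.divX) :=
      IsIntegral.of_mem_of_fg _ hint.fg_adjoin_singleton _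
        (Polynomial.aeval_mem_adjoin_singleton ℤ z)
    rcases Int.isUnit_iff.mp h0 with h | h <;> rw [h] at h1 <;> simp at h1
    · exact ⟨-Polynomial.aeval z p.divX, h2.neg, by linear_combination -h1⟩
    · exact ⟨Polynomial.aeval z p.divX, h2, by linear_combination h1⟩
  have rat_int : ∀ r : ℚ, IsIntegral ℤ (r : ℂ) → ∃ n : ℤ, (n : ℚ) = r := fun r hr =>
    IsIntegrallyClosed.isIntegral_iff.mp
      ((isIntegral_algebraMap_iff (algebraMap ℚ ℂ).injective).mp (by simpa using hr))
  obtain ⟨n, hn⟩ := rat_int q (hq ▸ hint.pow k)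
  have hqw : (q : ℂ) * w ^ k = 1 := by rw [← hq, ← mul_pow, hzw, one_pow]
  have hq0 : (q : ℂ) ≠ 0 := left_ne_zero_of_mul_eq_one hqw
  have hinv : ((q⁻¹ : ℚ) : ℂ) = w ^ k := by
    push_cast
    exact inv_eq_of_mul_eq_one_right hqw
  obtain ⟨m, hm⟩ := rat_int q⁻¹ (hinv ▸ hw.pow k)
  have hnm : n * m = 1 := by
    have : (n : ℚ) * m = 1 := by
      rw [hn, hm]
      exact mul_inv_cancel₀ (by exact_mod_cast hq0)
    exact_mod_cast this
  have hqn : ‖(q : ℂ)‖ = 1 := by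
    rw [← hn]
    rcases Int.isUnit_iff.mp (IsUnit.of_mul_eq_one m hnm) with h | h <;> simp [h]
  rw [← hq, norm_pow] at hqn
  exact (pow_eq_one_iff_of_nonneg (norm_nonneg z) hk).mp hqn

/-- No power of a hyperbolic map with integral unit characteristic polynomial has a rational
eigenvalue on the quotient by an invariant subspace. -/
theorem not_eigen_mod {M : Type*} [AddCommGroup M] [Module ℚ M] [Module.Finite ℚ M]
    {f : M →ₗ[ℚ] M} (hf : IsHyperbolic f) (hu : HasIntegralUnitCharpoly f) {k : ℕ} (hk : k ≠ 0)
    {N : Submodule ℚ M} (hN : ∀ x ∈ N, (f ^ k) x ∈ N) {z : M} {q : ℚ}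
    (hz : (f ^ k) z - q • z ∈ N) : z ∈ N := by
  set g : M →ₗ[ℚ] M := f ^ k - q • LinearMap.id with hg
  have hgN : ∀ x ∈ N, g x ∈ N := fun x hx => by
    simpa [hg] using N.sub_mem (hN x hx) (N.smul_mem q hx)
  -- If `g` is injective, finite dimension makes it bijective on `N`, so `g z ∈ N` forces `z ∈ N`.
  -- Otherwise `q` is an eigenvalue of `f ^ k`, and spectral mapping over `ℂ` yields an eigenvalue
  -- of `f` whose `k`-th power is `q`.
  by_cases hinj : Function.Injective g
  · have hsurj : Function.Surjective (g.restrict hgN) :=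
      LinearMap.injective_iff_surjective.mp fun x y hxy =>
        Subtype.ext (hinj (congrArg Subtype.val hxy))
    obtain ⟨y, hy⟩ := hsurj ⟨g z, by simpa [hg] using hz⟩
    have : (y : M) = z := hinj (congrArg Subtype.val hy)
    exact this ▸ y.2
  · exfalso
    obtain ⟨y, hy, hy0⟩ : ∃ y, g y = 0 ∧ y ≠ 0 := by
      by_contra! h
      exact hinj ((injective_iff_map_eq_zero g).mpr h)
    have hy1 : (f ^ k) y = q • y := by
      simpa [hg, sub_eq_zero] using hy
    have hpow : (f.baseChange ℂ) ^ k = (f ^ k).baseChange ℂ := 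
      (map_pow (Module.End.baseChangeHom ℚ ℂ M) f k).symm
    have hev : Module.End.HasEigenvalue ((f.baseChange ℂ) ^ k) (q : ℂ) := by
      refine Module.End.hasEigenvalue_of_hasEigenvector
        (x := (1 : ℂ) ⊗ₜ[ℚ] y) ⟨?_, ?_⟩
      · rw [Module.End.mem_eigenspace_iff, hpow, LinearMap.baseChange_tmul, hy1,
          ← TensorProduct.smul_tmul, TensorProduct.smul_tmul', Rat.smul_one_eq_cast]
        simp
      · intro h
        apply hy0
        have := Module.FaithfullyFlat.one_tmul_eq_zero_iff ℚ (A := ℂ) M y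
        exact this.mp h
    rw [Module.End.hasEigenvalue_iff_mem_spectrum,
      spectrum.map_pow_of_pos _ (Nat.pos_of_ne_zero hk)] at hev
    obtain ⟨w, hw, hwq⟩ := hev
    rw [← Module.End.hasEigenvalue_iff_mem_spectrum] at hw
    refine hf w hw ?_
    obtain ⟨p, hp, hp0⟩ := hu
    have hroot := (Module.End.hasEigenvalue_iff_isRoot_charpoly _ _).mp hw
    rw [LinearMap.charpoly_baseChange, ← hp, Polynomial.map_map] at hroot
    refine norm_eq_one_of_pow_eq_rat (p := p) ?_ hp0 ?_ hk hwq
    · have := f.charpoly_monic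
      rw [← hp] at this
      exact Polynomial.monic_of_injective (RingHom.injective_int _) this
    · rw [Polynomial.aeval_def, ← Polynomial.eval_map]
      exact hroot

/-! ### The graph bracket in edge coordinates -/

variable {S : Type*} {G : SimpleGraph S}

open Classical in
/-- The bracket `V × V → W` in coordinates, as a bilinear map. -/
noncomputable def br (G : SimpleGraph S) : (S → ℚ) →ₗ[ℚ] (S → ℚ) →ₗ[ℚ] (S → S → ℚ) :=
  LinearMap.mk₂ ℚ (fun u v a b => if G.Adj a b then u a * v b - u b * v a else 0)
    (fun u v w => by ext a b; dsimp; split_ifs <;> ring)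
    (fun t u v => by ext a b; dsimp; split_ifs <;> ring)
    (fun u v w => by ext a b; dsimp; split_ifs <;> ring)
    (fun t u v => by ext a b; dsimp; split_ifs <;> ring)

open Classical in
theorem br_apply (u v : S → ℚ) (a b : S) :
    br G u v a b = if G.Adj a b then u a * v b - u b * v a else 0 := rfl

theorem br_of_adj {a b : S} (h : G.Adj a b) (u v : S → ℚ) :
    br G u v a b = u a * v b - u b * v a := if_pos h

theorem br_of_not_adj {a b : S} (h : ¬ G.Adj a b) (u v : S → ℚ) : br G u v a b = 0 := if_neg h

theorem br_self (v : S → ℚ) : br G v v = 0 := by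
  ext a b
  rw [br_apply]
  split_ifs <;> simp [mul_comm]

theorem br_swap (u v : S → ℚ) : br G v u = -br G u v := by
  ext a b
  simp only [br_apply, Pi.neg_apply]
  split_ifs <;> ring

theorem br_eq_zero_iff {u v : S → ℚ} :
    br G u v = 0 ↔ ∀ a b, G.Adj a b → u a * v b = u b * v a := by
  constructor
  · intro h a b hab
    have := br_of_adj hab u v
    rw [h] at this
    exact (sub_eq_zero.mp this.symm)
  · intro h
    ext a b
    by_cases hab : G.Adj a b
    · rw [br_of_adj hab, h a b hab, sub_self]
      rfl
    · exact br_of_not_adj hab u v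

variable [DecidableEq S]

theorem detRowAlternating_funLeft {S : Type*} (a b : S) (v : Fin 2 → S → ℚ) :
    (Matrix.detRowAlternating (n := Fin 2) (R := ℚ)).compLinearMap
      (LinearMap.funLeft ℚ ℚ ![a, b]) v = v 0 a * v 1 b - v 0 b * v 1 a :=
  Matrix.det_fin_two (Matrix.of fun i j => v i (![a, b] j))

/-- The coordinate of a bivector at the pair `(a, b)`. -/
noncomputable def coordExt (a b : S) : ⋀[ℚ]^2 (S → ℚ) →ₗ[ℚ] ℚ :=
  exteriorPower.alternatingMapLinearEquiv
    ((Matrix.detRowAlternating (n := Fin 2) (R := ℚ)).compLinearMap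
      (LinearMap.funLeft ℚ ℚ ![a, b]))

theorem coordExt_wedge (a b p q : S) :
    coordExt a b (wedge p q) =
      (if a = p then 1 else 0) * (if b = q then 1 else 0) -
        (if b = p then 1 else 0) * (if a = q then 1 else 0) := by
  unfold coordExt wedge
  rw [exteriorPower.alternatingMapLinearEquiv_apply_ιMulti, detRowAlternating_funLeft]
  simp [Pi.single_apply]

/-- The coordinate of an element of the edge space at the pair `(a, b)`. -/
noncomputable def coord (G : SimpleGraph S) (a b : S) : edgeSpace G →ₗ[ℚ] ℚ :=
  (coordExt a b).comp (edgeSpace G).subtype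

theorem edgeVec_of_not_adj {a b : S} (h : ¬ G.Adj a b) : edgeVec G a b = 0 := dif_neg h

theorem coord_edgeVec {p q : S} (h : G.Adj p q) (a b : S) :
    coord G a b (edgeVec G p q) =
      (if a = p then 1 else 0) * (if b = q then 1 else 0) -
        (if b = p then 1 else 0) * (if a = q then 1 else 0) := by
  rw [edgeVec, dif_pos h]
  exact coordExt_wedge a b p q

theorem edgeSpace_induction {U : Type*}
    [AddCommGroup U] [Module ℚ U] {f g : edgeSpace G →ₗ[ℚ] U}
    (h : ∀ a b, G.Adj a b → f (edgeVec G a b) = g (edgeVec G a b)) : f = g := by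
  have hs : Submodule.span ℚ {w : edgeSpace G | ∃ a b, G.Adj a b ∧ w = edgeVec G a b} = ⊤ := by
    have := Submodule.span_span_coe_preimage (R := ℚ)
      (s := {w | ∃ a b, G.Adj a b ∧ w = wedge (S := S) a b})
    refine top_unique (this.ge.trans (Submodule.span_mono ?_))
    rintro ⟨w, hw⟩ ⟨a, b, hab, rfl⟩
    exact ⟨a, b, hab, by rw [edgeVec, dif_pos hab]; rfl⟩
  refine LinearMap.ext_on hs ?_
  rintro _ ⟨a, b, hab, rfl⟩
  exact h a b hab

theorem br_single_of_not_adj {a b : S} (h : ¬ G.Adj a b) :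
    br G (Pi.single a 1) (Pi.single b 1) = 0 := by
  ext c d
  rw [br_apply, Pi.single_apply, Pi.single_apply, Pi.single_apply, Pi.single_apply]
  split_ifs <;> simp_all [G.adj_comm]

theorem br_single_of_adj {p q : S} (hpq : G.Adj p q) (a b : S) :
    br G (Pi.single p 1) (Pi.single q 1) a b =
      (if a = p then (if b = q then 1 else 0) else 0) -
        (if a = q then (if b = p then 1 else 0) else 0) := by
  by_cases hab : G.Adj a b
  · rw [br_of_adj hab]
    simp only [Pi.single_apply]
    split_ifs <;> simp_all
  · rw [br_of_not_adj hab]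
    have h2 : a = p → b ≠ q := fun h h' => hab (h ▸ h' ▸ hpq)
    have h3 : a = q → b ≠ p := fun h h' => hab (h ▸ h' ▸ hpq.symm)
    split_ifs <;> simp_all

variable [Fintype S]

theorem single_ext {U : Type*} [AddCommGroup U] [Module ℚ U] {f g : (S → ℚ) →ₗ[ℚ] U}
    (h : ∀ a, f (Pi.single a 1) = g (Pi.single a 1)) : f = g :=
  (Pi.basisFun ℚ S).ext fun a => by simpa using h a

theorem single_ext₂ {U : Type*} [AddCommGroup U] [Module ℚ U]
    {f g : (S → ℚ) →ₗ[ℚ] (S → ℚ) →ₗ[ℚ] U}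
    (h : ∀ a b, f (Pi.single a 1) (Pi.single b 1) = g (Pi.single a 1) (Pi.single b 1)) : f = g :=
  single_ext fun a => single_ext fun b => h a b

/-- The linear map on edge coordinates induced by a bilinear map. -/
noncomputable def liftBr {U : Type*} [AddCommGroup U] [Module ℚ U]
    (B : (S → ℚ) →ₗ[ℚ] (S → ℚ) →ₗ[ℚ] U) : (S → S → ℚ) →ₗ[ℚ] U where
  -- The factor `2⁻¹` compensates for each edge occurring as both `(a, b)` and `(b, a)`.
  toFun w := (2⁻¹ : ℚ) • ∑ a, ∑ b, w a b • B (Pi.single a 1) (Pi.single b 1)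
  map_add' v w := by
    simp only [Pi.add_apply, add_smul, Finset.sum_add_distrib, smul_add]
  map_smul' t w := by
    simp only [Pi.smul_apply, smul_eq_mul, Finset.smul_sum, RingHom.id_apply, smul_smul,
      mul_left_comm]

theorem liftBr_apply {U : Type*} [AddCommGroup U] [Module ℚ U]
    (B : (S → ℚ) →ₗ[ℚ] (S → ℚ) →ₗ[ℚ] U) (w : S → S → ℚ) :
    liftBr B w = (2⁻¹ : ℚ) • ∑ a, ∑ b, w a b • B (Pi.single a 1) (Pi.single b 1) := rfl

/-- A bilinear map that is antisymmetric on vertices and vanishes on non-edges factors through the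
bracket. -/
theorem liftBr_br {U : Type*} [AddCommGroup U] [Module ℚ U]
    (B : (S → ℚ) →ₗ[ℚ] (S → ℚ) →ₗ[ℚ] U)
    (hB : ∀ a b, B (Pi.single b 1) (Pi.single a 1) = -B (Pi.single a 1) (Pi.single b 1))
    (hB0 : ∀ a b, ¬ G.Adj a b → B (Pi.single a 1) (Pi.single b 1) = 0) (u v : S → ℚ) :
    liftBr B (br G u v) = B u v := by
  have key : (br G).compr₂ (liftBr B) = B := by
    refine single_ext₂ fun p q => ?_
    rw [LinearMap.compr₂_apply]
    by_cases hpq : G.Adj p q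
    · simp only [liftBr_apply, br_single_of_adj hpq, sub_smul, Finset.sum_sub_distrib]
      simp only [ite_smul, one_smul, zero_smul, Finset.sum_ite_eq', Finset.mem_univ, if_true,
        Finset.sum_ite_irrel, Finset.sum_const_zero]
      rw [hB p q, sub_neg_eq_add, ← two_smul ℚ, smul_smul]
      norm_num
    · rw [br_single_of_not_adj hpq, map_zero, hB0 p q hpq]
  exact LinearMap.congr_fun₂ key u v

end GraphLie

/-! ### The domination preorder and its filtration -/

namespace GraphLie

section Domination

variable {S : Type*} (G : SimpleGraph S)

/-- Every neighbour of `s` other than `t` is a neighbour of `t`. -/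
def Dom (s t : S) : Prop := ∀ b, G.Adj s b → G.Adj t b ∨ b = t

variable {G}

theorem Dom.refl (s : S) : Dom G s s := fun _ h => Or.inl h

theorem Dom.adj {s t b : S} (h : Dom G s t) (hb : G.Adj s b) (hne : b ≠ t) : G.Adj t b :=
  (h b hb).resolve_right hne

theorem Dom.trans {s t r : S} (h₁ : Dom G s t) (h₂ : Dom G t r) : Dom G s r := by
  intro b hb
  by_cases hbr : b = r
  · exact Or.inr hbr
  left
  by_cases hbt : b = t
  · subst hbt
    by_cases hsr : s = r
    · exact hsr ▸ hb
    · have h3 : G.Adj r s := h₂.adj hb.symm hsr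
      exact (h₁.adj h3.symm (Ne.symm hbr)).symm
  · exact h₂.adj (h₁.adj hb hbt) hbr

variable (G)

/-- The vectors supported on the vertices below `x`. -/
def leSpace (x : S) : Submodule ℚ (S → ℚ) where
  carrier := {u | ∀ s, u s ≠ 0 → Dom G s x}
  zero_mem' s h := absurd rfl h
  add_mem' {u v} hu hv s h := by
    by_cases h0 : u s = 0
    · exact hv s fun h1 => h (by rw [Pi.add_apply, h0, h1, add_zero])
    · exact hu s h0
  smul_mem' t u hu s h := hu s (right_ne_zero_of_mul h)

/-- The vectors supported on the vertices strictly below `x`. -/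
def ltSpace (x : S) : Submodule ℚ (S → ℚ) where
  carrier := {u | ∀ s, u s ≠ 0 → Dom G s x ∧ ¬ Dom G x s}
  zero_mem' s h := absurd rfl h
  add_mem' {u v} hu hv s h := by
    by_cases h0 : u s = 0
    · exact hv s fun h1 => h (by rw [Pi.add_apply, h0, h1, add_zero])
    · exact hu s h0
  smul_mem' t u hu s h := hu s (right_ne_zero_of_mul h)

variable {G}

theorem mem_ltSpace_of_mem_leSpace {x : S} {u : S → ℚ} (hu : u ∈ leSpace G x)
    (h : ∀ s, Dom G x s → u s = 0) : u ∈ ltSpace G x :=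
  fun s hs => ⟨hu s hs, fun h' => hs (h s h')⟩

theorem single_mem_leSpace [DecidableEq S] {x y : S} (h : Dom G y x) :
    Pi.single y 1 ∈ leSpace G x := fun s hs => by
  by_cases hsy : s = y
  · exact hsy ▸ h
  · exact absurd (Pi.single_eq_of_ne hsy 1) hs

variable (G)

/-- The span of the brackets of vectors below `x` with vectors strictly below `x`. -/
def lowBr (x : S) : Submodule ℚ (S → S → ℚ) :=
  Submodule.span ℚ {w | ∃ u ∈ leSpace G x, ∃ v ∈ ltSpace G x, w = br G u v}

variable {G}

theorem br_mem_lowBr {x : S} {u v : S → ℚ} (hu : u ∈ leSpace G x) (hv : v ∈ ltSpace G x) :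
    br G u v ∈ lowBr G x := Submodule.subset_span ⟨u, hu, v, hv, rfl⟩

theorem br_mem_lowBr' {x : S} {u v : S → ℚ} (hu : u ∈ leSpace G x) (hv : v ∈ ltSpace G x) :
    br G v u ∈ lowBr G x := by
  rw [br_swap]
  exact neg_mem (br_mem_lowBr hu hv)

/-- A generator `[u, v]` has both factors supported below `x`, and `v` misses the class of `x`. So
its coordinates vanish at a pair with a vertex not below `x`, and at a pair inside or above the
class of `x`. -/
theorem apply_of_mem_lowBr {x : S} {w : S → S → ℚ} (hw : w ∈ lowBr G x) {a b : S}
    (hab : ¬ Dom G a x ∨ ¬ Dom G b x ∨ Dom G x a ∧ Dom G x b) : w a b = 0 := by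
  induction hw using Submodule.span_induction with
  | zero => rfl
  | add u v _ _ hu hv => rw [Pi.add_apply, Pi.add_apply, hu, hv, add_zero]
  | smul t u _ hu => rw [Pi.smul_apply, Pi.smul_apply, hu, smul_zero]
  | mem w hw =>
    obtain ⟨u, hu, v, hv, rfl⟩ := hw
    have hu' : ∀ s, ¬ Dom G s x → u s = 0 := fun s h => not_imp_comm.mp (hu s) h
    have hv' : ∀ s, ¬ Dom G s x ∨ Dom G x s → v s = 0 := fun s h =>
      not_imp_comm.mp (hv s) (by tauto)
    rw [br_apply]
    split_ifs with h
    · rcases hab with h1 | h1 | ⟨h1, h2⟩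
      · rw [hu' a h1, hv' a (Or.inl h1)]; ring
      · rw [hu' b h1, hv' b (Or.inl h1)]; ring
      · rw [hv' a (Or.inr h1), hv' b (Or.inr h2)]; ring
    · rfl

end Domination

/-! ### Triangular maps -/

variable {S : Type*} [DecidableEq S] {G : SimpleGraph S}

/-- The matrix entries of a linear map. -/
def ent (M : (S → ℚ) →ₗ[ℚ] (S → ℚ)) (s t : S) : ℚ := M (Pi.single t 1) s

/-- The linear map is triangular for the domination preorder. -/
def IsTri (G : SimpleGraph S) (M : (S → ℚ) →ₗ[ℚ] (S → ℚ)) : Prop :=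
  ∀ s t, ent M s t ≠ 0 → Dom G s t

theorem apply_eq_sum_ent [Fintype S] (M : (S → ℚ) →ₗ[ℚ] (S → ℚ)) (u : S → ℚ) (s : S) :
    M u s = ∑ t, u t * ent M s t := by
  conv_lhs => rw [← Finset.univ_sum_single u]
  rw [map_sum, Finset.sum_apply]
  refine Finset.sum_congr rfl fun t _ => ?_
  have : (Pi.single t (u t) : S → ℚ) = u t • Pi.single t 1 := by
    rw [← Pi.single_smul, smul_eq_mul, mul_one]
  rw [this, map_smul]
  rfl

theorem exists_of_apply_ne_zero [Fintype S] {M : (S → ℚ) →ₗ[ℚ] (S → ℚ)} (hM : IsTri G M)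
    {u : S → ℚ} {s : S} (h : M u s ≠ 0) : ∃ t, u t ≠ 0 ∧ Dom G s t := by
  rw [apply_eq_sum_ent] at h
  obtain ⟨t, _, ht⟩ := Finset.exists_ne_zero_of_sum_ne_zero h
  exact ⟨t, left_ne_zero_of_mul ht, hM s t (right_ne_zero_of_mul ht)⟩

theorem IsTri.map_leSpace [Fintype S] {M : (S → ℚ) →ₗ[ℚ] (S → ℚ)} (hM : IsTri G M) {x : S}
    {u : S → ℚ} (hu : u ∈ leSpace G x) : M u ∈ leSpace G x := fun _ h =>
  let ⟨t, ht, hst⟩ := exists_of_apply_ne_zero hM h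
  hst.trans (hu t ht)

theorem IsTri.map_ltSpace [Fintype S] {M : (S → ℚ) →ₗ[ℚ] (S → ℚ)} (hM : IsTri G M) {x : S}
    {u : S → ℚ} (hu : u ∈ ltSpace G x) : M u ∈ ltSpace G x := fun _ h =>
  let ⟨t, ht, hst⟩ := exists_of_apply_ne_zero hM h
  ⟨hst.trans (hu t ht).1, fun h' => (hu t ht).2 (h'.trans hst)⟩

/-- A vertex `a` in the support of `M s` is dominated by `s`; were `a` adjacent to `t`, so would be
`s`. This is what lets `M` extend to a derivation. -/
theorem IsTri.br_eq_zero {M : (S → ℚ) →ₗ[ℚ] (S → ℚ)} (hM : IsTri G M) {s t : S} (hne : s ≠ t)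
    (hst : ¬ G.Adj s t) : br G (M (Pi.single s 1)) (Pi.single t 1) = 0 := by
  have key : ∀ a, G.Adj a t → M (Pi.single s 1) a = 0 := fun a ha => by
    by_contra h
    exact hst ((hM a s h).adj ha hne.symm)
  rw [br_eq_zero_iff]
  intro a b hab
  by_cases hb : b = t
  · subst hb
    rw [key a hab, Pi.single_eq_of_ne hab.ne, zero_mul, mul_zero]
  · rw [Pi.single_eq_of_ne hb, mul_zero]
    by_cases ha : a = t
    · subst ha
      rw [key b hab.symm, zero_mul]
    · rw [Pi.single_eq_of_ne ha, mul_zero]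

/-- The data that a hyperbolic unimodular automorphism would provide: a triangular map `M` acting on
`V`, the induced map `F` on edge coordinates, for which `X = p [α, β] + q [γ, δ]` is an eigenvector
both for `F` and for the derivation induced by `M`, and such that there are no rational eigenvalues
on the relevant subquotients. -/
structure Config (G : SimpleGraph S) (M : (S → ℚ) →ₗ[ℚ] (S → ℚ))
    (F : (S → S → ℚ) →ₗ[ℚ] (S → S → ℚ)) (α β γ δ : S) (p q c μ : ℚ) (X : S → S → ℚ) : Prop where
  nodup : [α, β, γ, δ].Nodup
  adj₁ : G.Adj α β
  adj₂ : G.Adj γ δ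
  adj₃ : G.Adj α γ
  adj₄ : G.Adj α δ
  hp : p ≠ 0
  hq : q ≠ 0
  hX : X = p • br G (Pi.single α 1) (Pi.single β 1) + q • br G (Pi.single γ 1) (Pi.single δ 1)
  tri : IsTri G M
  map_br : ∀ u v, F (br G u v) = br G (M u) (M v)
  der : p • (br G (M (Pi.single α 1)) (Pi.single β 1) + br G (Pi.single α 1) (M (Pi.single β 1))) +
    q • (br G (M (Pi.single γ 1)) (Pi.single δ 1) + br G (Pi.single γ 1) (M (Pi.single δ 1))) = μ • X
  map : p • br G (M (Pi.single α 1)) (M (Pi.single β 1)) +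
    q • br G (M (Pi.single γ 1)) (M (Pi.single δ 1)) = c • X
  vertex : ∀ (x : S) (r : ℚ), M (Pi.single x 1) - r • (Pi.single x 1 : S → ℚ) ∉ ltSpace G x
  edge : ∀ x u v, F (br G u v) - c • br G u v ∈ lowBr G x →
    ∃ t : ℚ, br G u v - t • X ∈ lowBr G x

/-! ### Coordinate equations -/

namespace Config

variable {M : (S → ℚ) →ₗ[ℚ] (S → ℚ)} {F : (S → S → ℚ) →ₗ[ℚ] (S → S → ℚ)} {α β γ δ : S}
  {p q c μ : ℚ} {X : S → S → ℚ}

/-- The coefficients `p` and `q` in `Config` exist so that the relabellings `swap₂` and `flip` stay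
within the same family: exchanging `γ` and `δ` changes the sign of `q`. -/
theorem swap₂ (h : Config G M F α β γ δ p q c μ X) : Config G M F α β δ γ p (-q) c μ X where
  nodup := by
    have := h.nodup
    simp only [List.nodup_cons, List.mem_cons] at this ⊢
    tauto
  adj₁ := h.adj₁
  adj₂ := h.adj₂.symm
  adj₃ := h.adj₄
  adj₄ := h.adj₃
  hp := h.hp
  hq := neg_ne_zero.mpr h.hq
  hX := by rw [h.hX, br_swap (Pi.single δ 1), smul_neg, neg_smul]
  tri := h.tri
  map_br := h.map_br
  der := by
    rw [← h.der, br_swap (Pi.single δ 1), br_swap (M (Pi.single δ 1))]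
    module
  map := by
    rw [← h.map, br_swap (M (Pi.single δ 1))]
    module
  vertex := h.vertex
  edge := h.edge

theorem flip (h : Config G M F α β γ δ p q c μ X) (hβγ : G.Adj β γ) :
    Config G M F γ δ α β q p c μ X where
  nodup := by
    have := h.nodup
    simp only [List.nodup_cons, List.mem_cons] at this ⊢
    tauto
  adj₁ := h.adj₂
  adj₂ := h.adj₁
  adj₃ := h.adj₃.symm
  adj₄ := hβγ.symm
  hp := h.hq
  hq := h.hp
  hX := by rw [h.hX, add_comm]
  tri := h.tri
  map_br := h.map_br
  der := by rw [← h.der, add_comm]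
  map := by rw [← h.map, add_comm]
  vertex := h.vertex
  edge := h.edge

theorem der_apply (h : Config G M F α β γ δ p q c μ X) {a b : S} (hab : G.Adj a b) :
    p * (ent M a α * (Pi.single β 1 : S → ℚ) b - ent M b α * (Pi.single β 1 : S → ℚ) a +
        ((Pi.single α 1 : S → ℚ) a * ent M b β - (Pi.single α 1 : S → ℚ) b * ent M a β)) +
      q * (ent M a γ * (Pi.single δ 1 : S → ℚ) b - ent M b γ * (Pi.single δ 1 : S → ℚ) a +
        ((Pi.single γ 1 : S → ℚ) a * ent M b δ - (Pi.single γ 1 : S → ℚ) b * ent M a δ)) =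
    μ * (p * ((Pi.single α 1 : S → ℚ) a * (Pi.single β 1 : S → ℚ) b -
          (Pi.single α 1 : S → ℚ) b * (Pi.single β 1 : S → ℚ) a) +
        q * ((Pi.single γ 1 : S → ℚ) a * (Pi.single δ 1 : S → ℚ) b -
          (Pi.single γ 1 : S → ℚ) b * (Pi.single δ 1 : S → ℚ) a)) := by
  have := congrFun (congrFun h.der a) b
  rw [h.hX] at this
  simp only [Pi.add_apply, Pi.smul_apply, br_of_adj hab, smul_eq_mul] at this
  exact this

theorem map_apply (h : Config G M F α β γ δ p q c μ X) {a b : S} (hab : G.Adj a b) :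
    p * (ent M a α * ent M b β - ent M b α * ent M a β) +
      q * (ent M a γ * ent M b δ - ent M b γ * ent M a δ) =
    c * (p * ((Pi.single α 1 : S → ℚ) a * (Pi.single β 1 : S → ℚ) b -
          (Pi.single α 1 : S → ℚ) b * (Pi.single β 1 : S → ℚ) a) +
        q * ((Pi.single γ 1 : S → ℚ) a * (Pi.single δ 1 : S → ℚ) b -
          (Pi.single γ 1 : S → ℚ) b * (Pi.single δ 1 : S → ℚ) a)) := by
  have := congrFun (congrFun h.map a) b
  rw [h.hX] at this
  simp only [Pi.add_apply, Pi.smul_apply, br_of_adj hab, smul_eq_mul] at this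
  exact this

theorem nes (h : Config G M F α β γ δ p q c μ X) :
    α ≠ β ∧ α ≠ γ ∧ α ≠ δ ∧ β ≠ γ ∧ β ≠ δ ∧ γ ≠ δ := by
  have := h.nodup
  simp only [List.nodup_cons, List.mem_cons, List.not_mem_nil] at this
  tauto

/-- Since `s` dominates `α`, `sβ` is an edge, and at that edge `D X = μ X` reduces to `p * ent M s α
= 0`. -/
theorem ent_left_eq_zero (h : Config G M F α β γ δ p q c μ X) {s : S} (hs : Dom G α s)
    (h₁ : s ≠ α) (h₂ : s ≠ β) (h₃ : s ≠ γ) (h₄ : s ≠ δ) : ent M s α = 0 := by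
  obtain ⟨n1, n2, n3, n4, n5, n6⟩ := h.nes
  have := h.der_apply (hs.adj h.adj₁ h₂.symm)
  simpa [Pi.single_apply, h₁, h₂, h₃, h₄, n1, n2, n3, n4, n5, n6, n1.symm, n2.symm, n3.symm,
    n4.symm, n5.symm, n6.symm, h.hp] using this

theorem ent_right_eq_zero (h : Config G M F α β γ δ p q c μ X) {s : S} (hs : Dom G β s)
    (h₁ : s ≠ α) (h₂ : s ≠ β) (h₃ : s ≠ γ) (h₄ : s ≠ δ) : ent M s β = 0 := by
  obtain ⟨n1, n2, n3, n4, n5, n6⟩ := h.nes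
  have := h.der_apply (hs.adj h.adj₁.symm h₁.symm)
  simpa [Pi.single_apply, h₁, h₂, h₃, h₄, n1, n2, n3, n4, n5, n6, n1.symm, n2.symm, n3.symm,
    n4.symm, n5.symm, n6.symm, h.hp] using this

/-- The coordinate of the derivation equation at the edge `αβ`. -/
theorem der_trace (h : Config G M F α β γ δ p q c μ X) : ent M α α + ent M β β = μ := by
  obtain ⟨n1, n2, n3, n4, n5, n6⟩ := h.nes
  have := h.der_apply h.adj₁
  simp [n1, n2, n3, n4, n5, n1.symm] at this
  refine mul_left_cancel₀ h.hp ?_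
  linear_combination this

/-- `X` has no component at the edge `γβ`, so the coordinate of `D X` there is zero. -/
theorem der_cross (h : Config G M F α β γ δ p q c μ X) (hβγ : G.Adj β γ) :
    p * ent M γ α + q * ent M β δ = 0 := by
  obtain ⟨n1, n2, n3, n4, n5, n6⟩ := h.nes
  have := h.der_apply hβγ.symm
  simpa [Pi.single_apply, n1, n2, n3, n4, n5, n6, n1.symm, n2.symm, n3.symm,
    n4.symm, n5.symm, n6.symm] using this

/-- Otherwise `M x` would equal `ent M x x` times `x` modulo vertices strictly below `x`, giving a
rational eigenvalue on a subquotient. -/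
theorem exists_ent_ne_zero [Fintype S] (h : Config G M F α β γ δ p q c μ X) (x : S) :
    ∃ s, s ≠ x ∧ Dom G s x ∧ Dom G x s ∧ ent M s x ≠ 0 := by
  have hx := h.vertex x (ent M x x)
  by_contra! hcon
  refine hx (mem_ltSpace_of_mem_leSpace ?_ ?_)
  · exact sub_mem (h.tri.map_leSpace (single_mem_leSpace (Dom.refl x)))
      (Submodule.smul_mem _ _ (single_mem_leSpace (Dom.refl x)))
  · intro s hs
    by_cases hsx : s = x
    · subst hsx
      simp [ent]
    · have : ent M s x = 0 := by
        by_contra h0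
        exact h0 (hcon s hsx (h.tri s x h0) hs)
      simpa [hsx, ent] using this

end Config

end GraphLie

/-! ### Excluding every configuration -/

namespace GraphLie

namespace Config

variable {S : Type*} [DecidableEq S] [Fintype S] {G : SimpleGraph S}
  {M : (S → ℚ) →ₗ[ℚ] (S → ℚ)} {F : (S → S → ℚ) →ₗ[ℚ] (S → S → ℚ)} {α β γ δ : S}
  {p q c μ : ℚ} {X : S → S → ℚ}

/-- By `der_cross`, a nonzero entry at `(γ, α)` forces one at `(β, δ)`, so `β ≤ δ`. For the
converse, the class of `β` has a second member among `α, γ, δ`; if it is `α` or `γ`, then `α, β, γ`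
share a class, which the class of `δ` must meet. -/
theorem dom_of_ent_ne_zero (h : Config G M F α β γ δ p q c μ X) (h₁ : Dom G α γ) (h₂ : Dom G γ α)
    (h₃ : ent M γ α ≠ 0) : Dom G β δ ∧ Dom G δ β := by
  obtain ⟨n1, n2, n3, n4, n5, n6⟩ := h.nes
  have hβγ : G.Adj β γ := (h₁.adj h.adj₁ n4).symm
  have hβδ : Dom G β δ := by
    refine h.tri _ _ fun h0 => h₃ ?_
    have := h.der_cross hβγ
    rw [h0, mul_zero, add_zero] at this
    exact (mul_eq_zero.mp this).resolve_left h.hp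
  refine ⟨hβδ, ?_⟩
  have hαcase : Dom G α β → Dom G β α → Dom G δ β := fun h4 h5 => by
    obtain ⟨s, hsδ, hs1, hs2, hs3⟩ := h.exists_ent_ne_zero δ
    by_cases e1 : s = α
    · exact hs2.trans (e1 ▸ h4)
    by_cases e2 : s = β
    · exact e2 ▸ hs2
    by_cases e3 : s = γ
    · exact (e3 ▸ hs2).trans (h₂.trans h4)
    · exact absurd ((h.flip hβγ).ent_right_eq_zero hs2 e3 hsδ e1 e2) hs3
  obtain ⟨s, hsβ, hs1, hs2, hs3⟩ := h.exists_ent_ne_zero β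
  by_cases e1 : s = α
  · exact hαcase (e1 ▸ hs1) (e1 ▸ hs2)
  by_cases e2 : s = γ
  · exact hαcase (h₁.trans (e2 ▸ hs1)) ((e2 ▸ hs2).trans h₂)
  by_cases e3 : s = δ
  · exact e3 ▸ hs1
  · exact absurd (h.ent_right_eq_zero hs2 e1 hsβ e2 e3) hs3

theorem sum_ent_mul_ent (h : Config G M F α β γ δ p q c μ X) {s : S} (hs : Dom G α s) :
    M (M (Pi.single α 1)) s = ent M α α * ent M s α + ent M β α * ent M s β +
      ent M γ α * ent M s γ + ent M δ α * ent M s δ := by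
  obtain ⟨n1, n2, n3, n4, n5, n6⟩ := h.nes
  rw [apply_eq_sum_ent, ← Finset.sum_subset (Finset.subset_univ {α, β, γ, δ})]
  · rw [Finset.sum_insert, Finset.sum_insert, Finset.sum_insert, Finset.sum_singleton]
    · simp only [ent]
      ring
    all_goals simp [*]
  · intro t _ ht
    simp only [Finset.mem_insert, Finset.mem_singleton, not_or] at ht
    by_contra h0
    have h2 := h.tri s t (right_ne_zero_of_mul h0)
    exact left_ne_zero_of_mul h0
      (h.ent_left_eq_zero (hs.trans h2) ht.1 ht.2.1 ht.2.2.1 ht.2.2.2)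

/-- On the class of `α` the map `M` satisfies a quadratic equation. -/
theorem quadratic (h : Config G M F α β γ δ p q c μ X) (hβγ : G.Adj β γ) (hδβ : Dom G δ β)
    {s : S} (hs : Dom G α s) :
    M (M (Pi.single α 1)) s - μ * ent M s α + c * (Pi.single α 1 : S → ℚ) s = 0 := by
  obtain ⟨n1, n2, n3, n4, n5, n6⟩ := h.nes
  rw [h.sum_ent_mul_ent hs]
  have d1 := h.der_trace
  have d2 := h.der_cross hβγ
  have d3 : G.Adj β δ → p * ent M δ α - q * ent M β γ = 0 := fun hadj => by
    have := h.swap₂.der_cross hadj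
    linear_combination this
  -- `βδ` need not be an edge; but if `ent M s δ ≠ 0`, then `α ≤ s ≤ δ ≤ β` makes it one.
  have d4 : (p * ent M δ α - q * ent M β γ) * ent M s δ = 0 := by
    by_cases h0 : ent M s δ = 0
    · rw [h0, mul_zero]
    · rw [d3 (((hs.trans (h.tri s δ h0)).trans hδβ).adj h.adj₄ n5.symm), zero_mul]
  refine mul_left_cancel₀ h.hp ?_
  -- For `s ≠ β`, `sβ` is an edge, and `F X = c X` there supplies the constant term, as in
  -- Cayley–Hamilton. For `s = β` the relations from `D X = μ X` suffice.
  by_cases hsβ : s = β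
  · subst hsβ
    have d5 := d3 (hs.adj h.adj₄ n5.symm)
    rw [Pi.single_eq_of_ne n1.symm]
    linear_combination (p * ent M s α) * d1 + ent M s γ * d2 + ent M s δ * d5
  · have m1 := h.map_apply (hs.adj h.adj₁ (Ne.symm hsβ))
    simp only [Pi.single_eq_same, Pi.single_eq_of_ne n1.symm, Pi.single_eq_of_ne hsβ,
      Pi.single_eq_of_ne n4, Pi.single_eq_of_ne n5] at m1
    linear_combination (p * ent M s α) * d1 + ent M s γ * d2 + d4 - m1

theorem false_of_ent_ne_zero (h : Config G M F α β γ δ p q c μ X) (h₁ : Dom G α γ)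
    (h₂ : Dom G γ α) (h₃ : ent M γ α ≠ 0) : False := by
  obtain ⟨n1, n2, n3, n4, n5, n6⟩ := h.nes
  have hβγ : G.Adj β γ := (h₁.adj h.adj₁ n4).symm
  obtain ⟨-, hδβ⟩ := h.dom_of_ent_ne_zero h₁ h₂ h₃
  set e : S → ℚ := Pi.single α 1 with he
  have heα : e ∈ leSpace G α := single_mem_leSpace (Dom.refl α)
  have hMe := h.tri.map_leSpace heα
  have hv : M (M e) - μ • M e + c • e ∈ ltSpace G α := by
    refine mem_ltSpace_of_mem_leSpace ?_ fun s hs => h.quadratic hβγ hδβ hs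
    exact add_mem (sub_mem (h.tri.map_leSpace hMe) (Submodule.smul_mem _ _ hMe))
      (Submodule.smul_mem _ _ heα)
  -- With `M² e = μ M e - c e` modulo lower terms, `F [M e, e] = [M² e, M e]` is `c [M e, e]` modulo
  -- lower terms.
  obtain ⟨t, ht⟩ := h.edge α (M e) e (by
    have : F (br G (M e) e) - c • br G (M e) e = br G (M (M e) - μ • M e + c • e) (M e) := by
      rw [h.map_br]
      simp only [map_add, map_sub, map_smul, LinearMap.add_apply, LinearMap.sub_apply,
        LinearMap.smul_apply, br_self]
      rw [br_swap (M e) e]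
      module
    rw [this]
    exact br_mem_lowBr' hMe hv)
  -- At `(γ, α)` both `X` and the lower brackets vanish, while `[M e, e]` has coordinate `ent M γ
  -- α`.
  have h4 := apply_of_mem_lowBr ht (a := γ) (b := α) (Or.inr (Or.inr ⟨h₁, Dom.refl α⟩))
  simp only [h.hX, Pi.sub_apply, Pi.smul_apply, Pi.add_apply, br_of_adj h.adj₃.symm] at h4
  simp [he, n1, n2, n3, n6, n2.symm, n4.symm] at h4
  exact h₃ h4

/-- If one of the two entries linked by `der_cross` is nonzero, so is the other, and then `α ≤ β ≤ δ
≤ γ ≤ α`, which `false_of_ent_ne_zero` excludes. -/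
theorem cross_eq_zero (h : Config G M F α β γ δ p q c μ X) (hβγ : G.Adj β γ) (h₁ : Dom G α β)
    (h₂ : Dom G δ γ) : ent M γ α = 0 ∧ ent M β δ = 0 := by
  have d := h.der_cross hβγ
  have h0 : ent M γ α = 0 := by
    by_contra h3
    have h4 : ent M β δ ≠ 0 := fun h5 => by
      rw [h5, mul_zero, add_zero] at d
      exact h3 ((mul_eq_zero.mp d).resolve_left h.hp)
    exact h.false_of_ent_ne_zero ((h₁.trans (h.tri _ _ h4)).trans h₂) (h.tri _ _ h3) h3
  refine ⟨h0, ?_⟩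
  rw [h0, mul_zero, zero_add] at d
  exact (mul_eq_zero.mp d).resolve_left h.hq

/-- The entries of `M` between `{α, β}` and `{γ, δ}` needed here vanish, so on the class of `α` the
map `M` preserves the span of `α, β` modulo lower terms. The determinant of this block is `c`, hence
`[α, β]` satisfies the eigenvector equation for `c` modulo lower terms, although it is not a
multiple of `X`. -/
theorem false_of_blocks (h : Config G M F α β γ δ p q c μ X) (hβγ : G.Adj β γ) (hβδ : G.Adj β δ)
    (h₁ : Dom G α β) (h₂ : Dom G β α) (h₃ : Dom G γ δ) (h₄ : Dom G δ γ)
    (h₅ : ¬ Dom G γ α ∨ Dom G α γ) : False := by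
  obtain ⟨n1, n2, n3, n4, n5, n6⟩ := h.nes
  have hflip : Config G M F β α γ δ (-p) q c μ X :=
    (h.flip hβγ).swap₂.flip hβδ.symm
  obtain ⟨z1, z2⟩ := h.cross_eq_zero hβγ h₁ h₄
  obtain ⟨z3, z4⟩ := h.swap₂.cross_eq_zero hβδ h₁ h₃
  obtain ⟨z5, z6⟩ := hflip.cross_eq_zero h.adj₃ h₂ h₄
  obtain ⟨z7, z8⟩ := hflip.swap₂.cross_eq_zero h.adj₄ h₂ h₃
  have hdet : ent M α α * ent M β β - ent M β α * ent M α β = c := by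
    have m := h.map_apply h.adj₁
    simp [Pi.single_apply, n1, n2, n3, n1.symm, z2, z4] at m
    refine mul_left_cancel₀ h.hp ?_
    linear_combination m
  set e : S → ℚ := Pi.single α 1 with he
  set e' : S → ℚ := Pi.single β 1 with he'
  have heα : e ∈ leSpace G α := single_mem_leSpace (Dom.refl α)
  have heβ : e' ∈ leSpace G α := single_mem_leSpace h₂
  have hMα := h.tri.map_leSpace heα
  have hMβ := h.tri.map_leSpace heβ
  obtain ⟨v, hv⟩ : ∃ v, v = M e - ent M α α • e - ent M β α • e' := ⟨_, rfl⟩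
  obtain ⟨w, hw⟩ : ∃ w, w = M e' - ent M α β • e - ent M β β • e' := ⟨_, rfl⟩
  have hvlt : v ∈ ltSpace G α := by
    refine mem_ltSpace_of_mem_leSpace ?_ fun s hs => ?_
    · rw [hv]
      exact sub_mem (sub_mem hMα (Submodule.smul_mem _ _ heα)) (Submodule.smul_mem _ _ heβ)
    · have : v s = ent M s α - ent M α α * e s - ent M β α * e' s := by rw [hv]; rfl
      rw [this, he, he', Pi.single_apply, Pi.single_apply]
      by_cases e1 : s = α
      · subst e1
        simp [n1]
      by_cases e2 : s = β
      · subst e2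
        simp [n1.symm]
      by_cases e3 : s = γ
      · subst e3
        simp [z1, e1, e2]
      by_cases e4 : s = δ
      · subst e4
        simp [z3, e1, e2]
      simp [e1, e2, h.ent_left_eq_zero hs e1 e2 e3 e4]
  have hwlt : w ∈ ltSpace G α := by
    refine mem_ltSpace_of_mem_leSpace ?_ fun s hs => ?_
    · rw [hw]
      exact sub_mem (sub_mem hMβ (Submodule.smul_mem _ _ heα)) (Submodule.smul_mem _ _ heβ)
    · have : w s = ent M s β - ent M α β * e s - ent M β β * e' s := by rw [hw]; rfl
      rw [this, he, he', Pi.single_apply, Pi.single_apply]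
      by_cases e1 : s = α
      · subst e1
        simp [n1]
      by_cases e2 : s = β
      · subst e2
        simp [n1.symm]
      by_cases e3 : s = γ
      · subst e3
        simp [z5, e1, e2]
      by_cases e4 : s = δ
      · subst e4
        simp [z7, e1, e2]
      simp [e1, e2, h.ent_right_eq_zero (h₂.trans hs) e1 e2 e3 e4]
  have hM1 : M e = ent M α α • e + ent M β α • e' + v := by rw [hv]; module
  have hM2 : M e' = ent M α β • e + ent M β β • e' + w := by rw [hw]; module
  obtain ⟨t, ht⟩ := h.edge α e e' (by
    have : F (br G e e') - c • br G e e' =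
        br G (ent M α α • e + ent M β α • e') w + br G v (M e') := by
      rw [h.map_br, hM1, hM2, ← hdet]
      simp only [map_add, map_smul, LinearMap.add_apply, LinearMap.smul_apply, br_self]
      rw [br_swap e e']
      module
    rw [this]
    refine add_mem (br_mem_lowBr ?_ hwlt) (br_mem_lowBr' hMβ hvlt)
    exact add_mem (Submodule.smul_mem _ _ heα) (Submodule.smul_mem _ _ heβ))
  have c1 := apply_of_mem_lowBr ht (a := α) (b := β) (Or.inr (Or.inr ⟨Dom.refl α, h₁⟩))
  -- The hypothesis `h₅` guarantees that lower brackets do not reach the edge `γδ`. The coordinate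
  -- there gives `t = 0`, while the one at `αβ` requires `1 = t`.
  have c2 := apply_of_mem_lowBr ht (a := γ) (b := δ) (by
    rcases h₅ with h5 | h5
    · exact Or.inl h5
    · exact Or.inr (Or.inr ⟨h5, h5.trans h₃⟩))
  simp only [h.hX, Pi.sub_apply, Pi.smul_apply, Pi.add_apply, br_of_adj h.adj₁,
    br_of_adj h.adj₂] at c1 c2
  simp [he, he', n1, n2, n3, n4, n5, n6, n1.symm, n2.symm, n3.symm, n4.symm, n5.symm, n6.symm,
    h.hq] at c1 c2
  simp [c2] at c1

theorem elim (h : Config G M F α β γ δ p q c μ X) : False := by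
  obtain ⟨n1, n2, n3, n4, n5, n6⟩ := h.nes
  obtain ⟨s, hsα, hs1, hs2, hs3⟩ := h.exists_ent_ne_zero α
  by_cases e1 : s = γ
  · subst e1
    exact h.false_of_ent_ne_zero hs2 hs1 hs3
  by_cases e2 : s = δ
  · subst e2
    exact h.swap₂.false_of_ent_ne_zero hs2 hs1 hs3
  by_cases e3 : s = β
  swap
  · exact hs3 (h.ent_left_eq_zero hs2 hsα e3 e1 e2)
  subst e3
  have hβγ : G.Adj s γ := hs2.adj h.adj₃ n4.symm
  have hβδ : G.Adj s δ := hs2.adj h.adj₄ n5.symm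
  have hf := h.flip hβγ
  obtain ⟨r, hrγ, hr1, hr2, hr3⟩ := h.exists_ent_ne_zero γ
  by_cases e1 : r = α
  · subst e1
    exact hf.false_of_ent_ne_zero hr2 hr1 hr3
  by_cases e2 : r = s
  · subst e2
    exact hf.swap₂.false_of_ent_ne_zero hr2 hr1 hr3
  by_cases e3 : r = δ
  swap
  · exact hr3 (hf.ent_left_eq_zero hr2 hrγ e3 e1 e2)
  subst e3
  -- The side condition can fail only if `γ` is strictly below `α`; it then holds with the two pairs
  -- exchanged.
  by_cases h5 : ¬ Dom G γ α ∨ Dom G α γ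
  · exact h.false_of_blocks hβγ hβδ hs2 hs1 hr2 hr1 h5
  · exact hf.false_of_blocks h.adj₄.symm hβδ.symm hr2 hr1 hs2 hs1 (Or.inl (not_or.mp h5).2)

end Config

end GraphLie

/-! ### Centraliser dimensions and triangularity of a power -/

namespace GraphLie

variable {S : Type*} {G : SimpleGraph S}

/-- The dimension of the centraliser of a vector. -/
noncomputable def centDim (G : SimpleGraph S) (v : S → ℚ) : ℕ :=
  Module.finrank ℚ (LinearMap.ker (br G v))

theorem mem_cent {u v : S → ℚ} :
    u ∈ LinearMap.ker (br G v) ↔ ∀ a b, G.Adj a b → v a * u b = v b * u a := by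
  rw [LinearMap.mem_ker, br_eq_zero_iff]

theorem centDim_le_mul_of_ne [Fintype S] {d : S → ℚ} (hd : ∀ s, d s ≠ 0) (v : S → ℚ) :
    centDim G v ≤ centDim G (d * v) := by
  have hmaps : ∀ u ∈ LinearMap.ker (br G v), LinearMap.mulLeft ℚ d u ∈
      LinearMap.ker (br G (d * v)) := fun u hu => by
    rw [mem_cent] at hu ⊢
    intro a b hab
    simp only [LinearMap.mulLeft_apply, Pi.mul_apply]
    linear_combination (d a * d b) * hu a b hab
  refine LinearMap.finrank_le_finrank_of_injective (f := (LinearMap.mulLeft ℚ d).restrict hmaps)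
    fun u w huw => Subtype.ext (funext fun s => ?_)
  exact mul_left_cancel₀ (hd s) (congrFun (congrArg Subtype.val huw) s)

theorem centDim_map {f : (S → ℚ) ≃ₗ[ℚ] (S → ℚ)} (hf : ∀ u v, br G (f u) (f v) = 0 ↔ br G u v = 0)
    (v : S → ℚ) : centDim G (f v) = centDim G v := by
  have : LinearMap.ker (br G (f v)) = (LinearMap.ker (br G v)).map (f : (S → ℚ) →ₗ[ℚ] (S → ℚ)) := by
    ext u
    rw [LinearMap.mem_ker, Submodule.mem_map]
    constructor
    · intro h
      refine ⟨f.symm u, ?_, f.apply_symm_apply u⟩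
      rw [LinearMap.mem_ker, ← hf, f.apply_symm_apply, h]
    · rintro ⟨w, hw, rfl⟩
      exact (hf v w).mpr hw
  rw [centDim, this]
  exact LinearEquiv.finrank_map_eq f _

variable (G) in
/-- The subspace consists of vectors whose centraliser has dimension at least `m`. -/
def CentGE (m : ℕ) (P : Submodule ℚ (S → ℚ)) : Prop := ∀ v ∈ P, m ≤ centDim G v

variable (G) in
/-- The maximal subspaces of the centraliser dimension strata. -/
def strata : Set (Submodule ℚ (S → ℚ)) := {P | ∃ m, Maximal (CentGE G m) P}

theorem map_mem_strata {f : (S → ℚ) ≃ₗ[ℚ] (S → ℚ)}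
    (hf : ∀ u v, br G (f u) (f v) = 0 ↔ br G u v = 0) {P : Submodule ℚ (S → ℚ)}
    (hP : P ∈ strata G) : P.map (f : (S → ℚ) →ₗ[ℚ] (S → ℚ)) ∈ strata G := by
  obtain ⟨m, hm, hmax⟩ := hP
  refine ⟨m, ?_, fun Q hQ hle => ?_⟩
  · rintro _ ⟨v, hv, rfl⟩
    exact (hm v hv).trans_eq (centDim_map hf v).symm
  · have h1 : CentGE G m (Q.comap (f : (S → ℚ) →ₗ[ℚ] (S → ℚ))) := fun v hv =>
      (hQ _ hv).trans_eq (centDim_map hf v)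
    intro u hu
    have h2 := hmax h1 (Submodule.map_le_iff_le_comap.mp hle)
    exact ⟨f.symm u, h2 (by simpa using hu), by simp⟩

variable [DecidableEq S]

/-- The projection that deletes the coordinate at `s`. -/
noncomputable def delCoord (s : S) : (S → ℚ) →ₗ[ℚ] (S → ℚ) :=
  LinearMap.id - (LinearMap.proj (R := ℚ) (φ := fun _ : S => ℚ) s).smulRight (Pi.single s 1)

theorem delCoord_same (s : S) (v : S → ℚ) : delCoord s v s = 0 := by
  simp [delCoord]

theorem delCoord_of_ne {s t : S} (h : t ≠ s) (v : S → ℚ) : delCoord s v t = v t := by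
  simp [delCoord, h]

variable [Fintype S]

/-- If `s` has a neighbour `t` in the support of `v`, deleting the coordinate `s` is injective on
the centraliser of `v`, since a nonzero multiple of `s` does not commute with `v`. Otherwise the
centraliser of `v` already centralises the truncated vector. The vanishing clause serves the strict
inequality in `centDim_lt_delCoord`. -/
theorem exists_cent_delCoord {v : S → ℚ} {s : S} (hs : v s ≠ 0) :
    ∃ Z : Submodule ℚ (S → ℚ), Z ≤ LinearMap.ker (br G (delCoord s v)) ∧
      Module.finrank ℚ Z = centDim G v ∧ ∀ u ∈ Z, ∀ b, G.Adj s b → v b = 0 → u b = 0 := by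
  have hz : ∀ u ∈ LinearMap.ker (br G v), ∀ b, G.Adj s b → v b = 0 → u b = 0 := by
    intro u hu b hb hvb
    have := mem_cent.mp hu s b hb
    rw [hvb, zero_mul] at this
    exact (mul_eq_zero.mp this).resolve_left hs
  by_cases h : ∃ t, G.Adj s t ∧ v t ≠ 0
  · obtain ⟨t, hst, ht⟩ := h
    refine ⟨(LinearMap.ker (br G v)).map (delCoord s), ?_, ?_, ?_⟩
    · rintro _ ⟨u, hu, rfl⟩
      rw [mem_cent]
      intro a b hab
      by_cases ha : a = s
      · subst ha
        rw [delCoord_same, delCoord_same, zero_mul, mul_zero]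
      by_cases hb : b = s
      · subst hb
        rw [delCoord_same, delCoord_same, zero_mul, mul_zero]
      rw [delCoord_of_ne ha, delCoord_of_ne hb, delCoord_of_ne ha, delCoord_of_ne hb]
      exact mem_cent.mp hu a b hab
    · rw [← LinearMap.range_domRestrict]
      refine LinearMap.finrank_range_of_inj ((injective_iff_map_eq_zero _).mpr ?_)
      rintro ⟨u, hu⟩ h0
      have h1 : ∀ a, a ≠ s → u a = 0 := fun a ha => by
        rw [← delCoord_of_ne ha u]
        exact congrFun h0 a
      refine Subtype.ext (funext fun a => ?_)
      by_cases ha : a = s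
      · subst ha
        have h2 := mem_cent.mp hu a t hst
        rw [h1 t hst.ne', mul_zero] at h2
        exact (mul_eq_zero.mp h2.symm).resolve_left ht
      · exact h1 a ha
    · rintro _ ⟨u, hu, rfl⟩ b hb hvb
      rw [delCoord_of_ne hb.ne']
      exact hz u hu b hb hvb
  · push Not at h
    refine ⟨LinearMap.ker (br G v), fun u hu => ?_, rfl, hz⟩
    rw [mem_cent] at hu ⊢
    intro a b hab
    by_cases ha : a = s
    · subst ha
      rw [delCoord_same, delCoord_of_ne hab.ne', h b hab, zero_mul, zero_mul]
    by_cases hb : b = s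
    · subst hb
      rw [delCoord_same, delCoord_of_ne hab.ne, h a hab.symm, zero_mul, zero_mul]
    rw [delCoord_of_ne ha, delCoord_of_ne hb]
    exact hu a b hab

theorem centDim_le_delCoord (v : S → ℚ) (s : S) : centDim G v ≤ centDim G (delCoord s v) := by
  by_cases hs : v s = 0
  · have : delCoord s v = v := by simp [delCoord, hs]
    rw [this]
  · obtain ⟨Z, hZ, hd, -⟩ := exists_cent_delCoord (G := G) hs
    rw [← hd]
    exact Submodule.finrank_mono hZ

theorem centDim_lt_delCoord {v : S → ℚ} {s b : S} (hs : v s ≠ 0) (hb : G.Adj s b) (hvb : v b = 0)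
    (h : Pi.single b 1 ∈ LinearMap.ker (br G (delCoord s v))) :
    centDim G v < centDim G (delCoord s v) := by
  obtain ⟨Z, hZ, hd, hZ0⟩ := exists_cent_delCoord (G := G) hs
  rw [← hd]
  refine Submodule.finrank_lt_finrank_of_lt (lt_of_le_of_ne hZ fun heq => ?_)
  have := hZ0 _ (heq ▸ h) b hb hvb
  simp at this

theorem centDim_le_mul (d v : S → ℚ) : centDim G v ≤ centDim G (d * v) := by
  have key : ∀ A : Finset S, centDim G v ≤ centDim G (fun s => if s ∈ A then 0 else v s) := by
    intro A
    induction A using Finset.induction_on with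
    | empty => simp
    | insert a A _ ih =>
      refine (ih.trans (centDim_le_delCoord _ a)).trans (le_of_eq ?_)
      congr 1
      ext s
      by_cases hs : s = a
      · subst hs
        rw [delCoord_same]
        simp
      · rw [delCoord_of_ne hs]
        simp [hs]
  -- The zeros of `d` are handled by deletion, after which `d` may be replaced by a nowhere
  -- vanishing function.
  refine (key (Finset.univ.filter fun s => d s = 0)).trans
    ((centDim_le_mul_of_ne (d := fun s => if d s = 0 then 1 else d s) (fun s => ?_) _).trans
      (le_of_eq ?_))
  · split_ifs with h
    · exact one_ne_zero
    · exact h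
  · congr 1
    ext s
    by_cases h : d s = 0 <;> simp [h]

/-- The vectors supported in `T`. -/
def coordSpace (T : Finset S) : Submodule ℚ (S → ℚ) where
  carrier := {u | ∀ s, s ∉ T → u s = 0}
  zero_mem' _ _ := rfl
  add_mem' {u v} hu hv s h := by rw [Pi.add_apply, hu s h, hv s h, add_zero]
  smul_mem' t u hu s h := by rw [Pi.smul_apply, hu s h, smul_zero]

theorem centDim_le_of_mem_coordSpace {v u : S → ℚ}
    (hu : u ∈ coordSpace (Finset.univ.filter fun s => v s ≠ 0)) : centDim G v ≤ centDim G u := by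
  have : u = (u / v) * v := by
    ext s
    by_cases hs : v s = 0
    · rw [hu s (by simpa using hs), Pi.mul_apply, hs, mul_zero]
    · rw [Pi.mul_apply, Pi.div_apply, div_mul_cancel₀ _ hs]
  rw [this]
  exact centDim_le_mul _ _

/-- Each vector of `P` lies in the coordinate space of its support, which satisfies the same bound.
These spaces are finite in number, and a vector space over the infinite field `ℚ` is not a finite
union of proper subspaces. -/
theorem exists_coordSpace_ge {m : ℕ} {P : Submodule ℚ (S → ℚ)} (hP : CentGE G m P) :
    ∃ T, P ≤ coordSpace T ∧ CentGE G m (coordSpace T) := by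
  have hcov : ⋃ T : {T // CentGE G m (coordSpace T)},
      (((coordSpace T.1).comap P.subtype : Subspace ℚ P) : Set P) = Set.univ := by
    refine Set.eq_univ_of_forall fun v => Set.mem_iUnion.mpr ?_
    refine ⟨⟨Finset.univ.filter fun s => v.1 s ≠ 0, fun u hu =>
      (hP v.1 v.2).trans (centDim_le_of_mem_coordSpace hu)⟩, fun s hs => ?_⟩
    simpa using hs
  obtain ⟨T, hT⟩ := Subspace.exists_eq_top_of_iUnion_eq_univ hcov
  exact ⟨T.1, fun v hv => (Submodule.eq_top_iff'.mp hT) ⟨v, hv⟩, T.2⟩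

theorem exists_eq_coordSpace {P : Submodule ℚ (S → ℚ)} (hP : P ∈ strata G) :
    ∃ T, coordSpace T = P := by
  obtain ⟨m, hm⟩ := hP
  obtain ⟨T, hT, hT'⟩ := exists_coordSpace_ge hm.1
  exact ⟨T, (hm.eq_of_le hT' hT).symm⟩

instance : Finite (strata G) :=
  ((Set.finite_range (coordSpace (S := S))).subset fun _ hP => exists_eq_coordSpace hP).to_subtype

/-- Some power of a linear automorphism preserving commutation is triangular. -/
theorem exists_pow_isTri {f : (S → ℚ) ≃ₗ[ℚ] (S → ℚ)}
    (hf : ∀ u v, br G (f u) (f v) = 0 ↔ br G u v = 0) :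
    ∃ k ≠ 0, IsTri G ((f : (S → ℚ) →ₗ[ℚ] (S → ℚ)) ^ k) := by
  let g : strata G → strata G := fun P => ⟨_, map_mem_strata hf P.2⟩
  have hg : Function.Injective g := fun P Q h => Subtype.ext
    (Submodule.map_injective_of_injective f.injective (congrArg Subtype.val h))
  let e : Equiv.Perm (strata G) := Equiv.ofBijective g (Finite.injective_iff_bijective.mp hg)
  have he : ∀ n : ℕ, ∀ P : strata G, ((e ^ n) P).1 =
      P.1.map ((f : (S → ℚ) →ₗ[ℚ] (S → ℚ)) ^ n) := by
    intro n
    induction n with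
    | zero =>
      intro P
      simp [Module.End.one_eq_id]
    | succ n ih =>
      intro P
      rw [pow_succ', pow_succ', Equiv.Perm.mul_apply, Module.End.mul_eq_comp, Submodule.map_comp,
        ← ih P]
      rfl
  obtain ⟨k, hk, hek⟩ := isOfFinOrder_iff_pow_eq_one.mp (isOfFinOrder_of_finite e)
  refine ⟨k, hk.ne', fun s t hst => ?_⟩
  by_contra hdom
  obtain ⟨b, hsb, hb⟩ : ∃ b, G.Adj s b ∧ ¬ (G.Adj t b ∨ b = t) := by
    simpa [Dom] using hdom
  push Not at hb
  have hne : s ≠ t := fun h => hdom (h ▸ Dom.refl s)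
  have h0 : CentGE G (centDim G (Pi.single t 1)) (Submodule.span ℚ {Pi.single t 1}) := by
    intro v hv
    obtain ⟨r, rfl⟩ := Submodule.mem_span_singleton.mp hv
    have : r • (Pi.single t 1 : S → ℚ) = (fun _ => r) * Pi.single t 1 := rfl
    rw [this]
    exact centDim_le_mul _ _
  -- A stratum `P` containing `t`, at the level of its own centraliser dimension. It is fixed by `f
  -- ^ k` and is a coordinate space, so it also contains `s`, hence `t + s`.
  obtain ⟨P, hP0, hP⟩ := exists_maximal_ge_of_wellFoundedGT _ _ h0
  have hPs : P ∈ strata G := ⟨_, hP⟩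
  have hmap : P.map ((f : (S → ℚ) →ₗ[ℚ] (S → ℚ)) ^ k) = P := by
    rw [← he k ⟨P, hPs⟩, hek]
    rfl
  have htP : Pi.single t 1 ∈ P := hP0 (Submodule.mem_span_singleton_self _)
  have hsP : ((f : (S → ℚ) →ₗ[ℚ] (S → ℚ)) ^ k) (Pi.single t 1) ∈ P :=
    hmap.le (Submodule.mem_map_of_mem htP)
  obtain ⟨T, rfl⟩ := exists_eq_coordSpace hPs
  have hsT : s ∈ T := by
    by_contra h
    exact hst (hsP s h)
  have htT : t ∈ T := by
    by_contra h
    simpa using htP t h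
  have hle := hP.1 (Pi.single t 1 + Pi.single s 1) (fun r hr => by
    have h1 : r ≠ t := fun h => hr (h ▸ htT)
    have h2 : r ≠ s := fun h => hr (h ▸ hsT)
    simp [h1, h2])
  have hdel : delCoord s (Pi.single t 1 + Pi.single s 1) = Pi.single t 1 := by
    ext r
    by_cases hr : r = s
    · subst hr
      rw [delCoord_same, Pi.single_eq_of_ne hne]
    · rw [delCoord_of_ne hr]
      simp [hr]
  -- The vertex `b` commutes with `t` but not with `t + s`, so the centraliser of `t + s` is too
  -- small for `P`.
  have hlt := centDim_lt_delCoord (G := G) (v := Pi.single t 1 + Pi.single s 1) (s := s) (b := b)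
    (by simp [hne]) hsb (by simp [hb.2, hsb.ne']) (by
      rw [hdel, LinearMap.mem_ker]
      exact br_single_of_not_adj hb.1)
  rw [hdel] at hlt
  omega

end GraphLie

/-! ### The quotient algebra and the induced map on `V` -/

namespace GraphLie

section Coordinates

variable {S : Type*} {G : SimpleGraph S}

variable (G) in
/-- The span of all brackets in edge coordinates. -/
def brSpan : Submodule ℚ (S → S → ℚ) := Submodule.span ℚ {w | ∃ u v, w = br G u v}

theorem br_mem_brSpan (u v : S → ℚ) : br G u v ∈ brSpan G := Submodule.subset_span ⟨u, v, rfl⟩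

variable [DecidableEq S]

theorem coord_edgeVec_eq_br (p q a b : S) :
    coord G a b (edgeVec G p q) = br G (Pi.single p 1) (Pi.single q 1) a b := by
  by_cases hpq : G.Adj p q
  · rw [coord_edgeVec hpq, br_single_of_adj hpq]
    split_ifs <;> norm_num
  · rw [edgeVec_of_not_adj hpq, map_zero, br_single_of_not_adj hpq]
    rfl

variable (G) in
/-- The coordinates of `[α, β] + [γ, δ]`. -/
noncomputable def quotCoord (α β γ δ : S) : S → S → ℚ :=
  br G (Pi.single α 1) (Pi.single β 1) + br G (Pi.single γ 1) (Pi.single δ 1)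

/-- The element `[α, β] + [γ, δ]` is not a scalar multiple of a bracket. -/
theorem br_ne_smul_quotCoord {α β γ δ : S} (hdistinct : [α, β, γ, δ].Nodup) (hαβ : G.Adj α β)
    (hγδ : G.Adj γ δ) (hαγ : G.Adj α γ) (hαδ : G.Adj α δ) {u v : S → ℚ} {t : ℚ}
    (h : br G u v = t • quotCoord G α β γ δ) : t = 0 := by
  obtain ⟨n1, n2, n3, n4, n5, n6⟩ : α ≠ β ∧ α ≠ γ ∧ α ≠ δ ∧ β ≠ γ ∧ β ≠ δ ∧ γ ≠ δ := by
    simp only [List.nodup_cons, List.mem_cons, List.not_mem_nil] at hdistinct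
    tauto
  have key : ∀ a b, G.Adj a b → u a * v b - u b * v a = t * quotCoord G α β γ δ a b :=
    fun a b hab => by
      rw [← br_of_adj hab u v, h]
      rfl
  have k1 := key _ _ hαβ
  have k2 := key _ _ hγδ
  have k3 := key _ _ hαγ
  have k4 := key _ _ hαδ
  simp only [quotCoord, Pi.add_apply, br_of_adj hαβ, br_of_adj hγδ, br_of_adj hαγ,
    br_of_adj hαδ] at k1 k2 k3 k4
  simp [n1, n2, n3, n4, n5, n6, n1.symm, n2.symm, n3.symm, n4.symm, n5.symm, n6.symm]
    at k1 k2 k3 k4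
  -- The Plücker relation for `u ∧ v` at `α, β, γ, δ`: its coordinates at `αβ` and `γδ` are `t`, and
  -- those at `αγ` and `αδ` vanish. The pairs `βγ` and `βδ` need not be edges.
  have : t * t = 0 := by
    nth_rewrite 1 [← k1]
    rw [← k2]
    linear_combination (u β * v δ - u δ * v β) * k3 - (u β * v γ - u γ * v β) * k4
  exact mul_self_eq_zero.mp this

variable [Fintype S]

theorem coord_edgeBracket (u v : S → ℚ) (a b : S) :
    coord G a b (edgeBracket G u v) = br G u v a b := by
  have hu := Finset.univ_sum_single u
  have hv := Finset.univ_sum_single v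
  have hs : ∀ (w : S → ℚ) (t : S), (Pi.single t (w t) : S → ℚ) = w t • Pi.single t 1 := by
    intro w t
    rw [← Pi.single_smul, smul_eq_mul, mul_one]
  rw [edgeBracket, map_sum]
  conv_rhs => rw [← hu, ← hv]
  simp only [map_sum, LinearMap.sum_apply, Finset.sum_apply, hs, map_smul, LinearMap.smul_apply,
    Pi.smul_apply, coord_edgeVec_eq_br, smul_eq_mul, Finset.mul_sum]
  rw [Finset.sum_comm]
  refine Finset.sum_congr rfl fun p _ => Finset.sum_congr rfl fun q _ => ?_
  ring

end Coordinates

namespace QuotLie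

variable {S : Type*} [Fintype S] [DecidableEq S] {G : SimpleGraph S} {α β γ δ : S}

variable (G α β γ δ) in
/-- The quotient map. -/
noncomputable def mk : NilLie G →ₗ[ℚ] QuotLie G α β γ δ :=
  (LieSubmodule.Quotient.mk' (quotIdeal G α β γ δ)).toLinearMap

theorem mk_surjective : Function.Surjective (mk G α β γ δ) :=
  LieSubmodule.Quotient.surjective_mk' _

theorem mk_lie (x y : NilLie G) :
    mk G α β γ δ ⁅x, y⁆ = ⁅mk G α β γ δ x, mk G α β γ δ y⁆ := rfl

theorem mk_eq_zero {x : NilLie G} :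
    mk G α β γ δ x = 0 ↔ ∃ t : ℚ, t • quotElt G α β γ δ = x :=
  (LieSubmodule.Quotient.mk_eq_zero (N := quotIdeal G α β γ δ)).trans Submodule.mem_span_singleton

variable (G) in
/-- The inclusion of `V`. -/
noncomputable def inV : (S → ℚ) →ₗ[ℚ] NilLie G := LinearMap.inl ℚ (S → ℚ) (edgeSpace G)

variable (G) in
/-- The inclusion of `W`. -/
noncomputable def inW : edgeSpace G →ₗ[ℚ] NilLie G := LinearMap.inr ℚ (S → ℚ) (edgeSpace G)

variable (G) in
/-- The projection to `V`. -/
noncomputable def fstV : NilLie G →ₗ[ℚ] (S → ℚ) := LinearMap.fst ℚ (S → ℚ) (edgeSpace G)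

variable (G) in
/-- The projection to `W`. -/
noncomputable def sndW : NilLie G →ₗ[ℚ] edgeSpace G := LinearMap.snd ℚ (S → ℚ) (edgeSpace G)

theorem fstV_quotElt : fstV G (quotElt G α β γ δ) = 0 := by
  change (0 : S → ℚ) + 0 = 0
  exact add_zero 0

variable (G α β γ δ) in
/-- The projection of the quotient algebra to `V`. -/
noncomputable def proj : QuotLie G α β γ δ →ₗ[ℚ] (S → ℚ) :=
  Submodule.liftQ (quotIdeal G α β γ δ).toSubmodule (fstV G) (by
    intro x hx
    obtain ⟨t, rfl⟩ := Submodule.mem_span_singleton.mp hx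
    rw [LinearMap.mem_ker, map_smul, fstV_quotElt, smul_zero])

theorem proj_lie (x y : QuotLie G α β γ δ) : proj G α β γ δ ⁅x, y⁆ = 0 := by
  obtain ⟨x, rfl⟩ := mk_surjective x
  obtain ⟨y, rfl⟩ := mk_surjective y
  rfl

variable (G α β γ δ) in
/-- The bracket of the quotient algebra restricted to `V`. -/
noncomputable def brQ : (S → ℚ) →ₗ[ℚ] (S → ℚ) →ₗ[ℚ] QuotLie G α β γ δ :=
  LinearMap.mk₂ ℚ (fun u v => ⁅mk G α β γ δ (inV G u), mk G α β γ δ (inV G v)⁆)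
    (fun u v w => by simp only [map_add, add_lie])
    (fun t u v => by simp only [map_smul, smul_lie])
    (fun u v w => by simp only [map_add, lie_add])
    (fun t u v => by simp only [map_smul, lie_smul])

theorem brQ_apply (u v : S → ℚ) :
    brQ G α β γ δ u v = ⁅mk G α β γ δ (inV G u), mk G α β γ δ (inV G v)⁆ := rfl

theorem brQ_eq_mk (u v : S → ℚ) :
    brQ G α β γ δ u v = mk G α β γ δ (inW G (edgeBracket G u v)) := rfl

theorem lie_eq_brQ (x y : QuotLie G α β γ δ) :
    ⁅x, y⁆ = brQ G α β γ δ (proj G α β γ δ x) (proj G α β γ δ y) := by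
  obtain ⟨x, rfl⟩ := mk_surjective x
  obtain ⟨y, rfl⟩ := mk_surjective y
  rfl

variable (G α β γ δ) in
/-- The map from edge coordinates to the quotient algebra. -/
noncomputable def ofCoord : (S → S → ℚ) →ₗ[ℚ] QuotLie G α β γ δ := liftBr (brQ G α β γ δ)

theorem ofCoord_br (u v : S → ℚ) : ofCoord G α β γ δ (br G u v) = brQ G α β γ δ u v := by
  refine liftBr_br _ (fun a b => ?_) (fun a b hab => ?_) u v
  · rw [brQ_apply, brQ_apply, lie_skew]
  · have h := vertex_lie_vertex G a b
    rw [edgeVec_of_not_adj hab] at h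
    have h2 : brQ G α β γ δ (Pi.single a 1) (Pi.single b 1) =
      mk G α β γ δ ⁅vertex G a, vertex G b⁆ := rfl
    rw [h2, h]
    exact map_zero _

theorem coord_quotElt (a b : S) :
    coord G a b (sndW G (quotElt G α β γ δ)) = quotCoord G α β γ δ a b := by
  rw [quotElt, map_add, map_add, vertex_lie_vertex, vertex_lie_vertex]
  exact congrArg₂ (· + ·) (coord_edgeVec_eq_br α β a b) (coord_edgeVec_eq_br γ δ a b)

/-- Membership in `brSpan` is essential: `ofCoord` is defined on all arrays and also kills, for
instance, the symmetric ones. -/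
theorem ofCoord_eq_zero {w : S → S → ℚ} (hw : w ∈ brSpan G) (h : ofCoord G α β γ δ w = 0) :
    ∃ t : ℚ, w = t • quotCoord G α β γ δ := by
  obtain ⟨e, he, hew⟩ : ∃ e : edgeSpace G, ofCoord G α β γ δ w = mk G α β γ δ (inW G e) ∧
      ∀ a b, coord G a b e = w a b := by
    clear h
    induction hw using Submodule.span_induction with
    | mem w hw =>
      obtain ⟨u, v, rfl⟩ := hw
      exact ⟨edgeBracket G u v, by rw [ofCoord_br, brQ_eq_mk], coord_edgeBracket u v⟩
    | zero => exact ⟨0, by simp only [map_zero], fun a b => map_zero _⟩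
    | add w₁ w₂ _ _ h₁ h₂ =>
      obtain ⟨e₁, h₁, h₁'⟩ := h₁
      obtain ⟨e₂, h₂, h₂'⟩ := h₂
      exact ⟨e₁ + e₂, by rw [map_add, h₁, h₂, map_add, map_add], fun a b => by
        rw [map_add, h₁', h₂']; rfl⟩
    | smul t w _ h =>
      obtain ⟨e, h, h'⟩ := h
      exact ⟨t • e, by rw [map_smul, h, map_smul, map_smul], fun a b => by
        rw [map_smul, h']; rfl⟩
  rw [h] at he
  obtain ⟨t, ht⟩ := mk_eq_zero.mp he.symm
  refine ⟨t, funext fun a => funext fun b => ?_⟩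
  rw [← hew, Pi.smul_apply, Pi.smul_apply, ← coord_quotElt, ← map_smul, ← map_smul, ht]
  rfl

theorem ofCoord_quotCoord : ofCoord G α β γ δ (quotCoord G α β γ δ) = 0 := by
  rw [quotCoord, map_add, ofCoord_br, ofCoord_br]
  exact mk_eq_zero.mpr ⟨1, one_smul _ _⟩

section Automorphism

variable (σ : QuotLie G α β γ δ ≃ₗ⁅ℚ⁆ QuotLie G α β γ δ)

/-- The map induced on `V` by an automorphism. -/
noncomputable def induced : (S → ℚ) →ₗ[ℚ] (S → ℚ) :=
  (proj G α β γ δ).comp ((σ : QuotLie G α β γ δ →ₗ[ℚ] QuotLie G α β γ δ).comp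
    ((mk G α β γ δ).comp (inV G)))

/-- The image of `W` is spanned by brackets, so `σ` sends it to brackets, which `proj` kills. -/
theorem proj_apply (x : QuotLie G α β γ δ) :
    proj G α β γ δ (σ x) = induced σ (proj G α β γ δ x) := by
  obtain ⟨x, rfl⟩ := mk_surjective x
  have hW : (proj G α β γ δ).comp ((σ : QuotLie G α β γ δ →ₗ[ℚ] QuotLie G α β γ δ).comp
      ((mk G α β γ δ).comp (inW G))) = 0 := by
    refine edgeSpace_induction fun a b _ => ?_
    have h1 : mk G α β γ δ (inW G (edgeVec G a b)) =
        ⁅mk G α β γ δ (vertex G a), mk G α β γ δ (vertex G b)⁆ := by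
      rw [← mk_lie, vertex_lie_vertex]
      rfl
    change proj G α β γ δ (σ (mk G α β γ δ (inW G (edgeVec G a b)))) = 0
    rw [h1, LieEquiv.map_lie, proj_lie]
  have hx : x = inV G (fstV G x) + inW G (sndW G x) :=
    Prod.ext (add_zero _).symm (zero_add _).symm
  have h2 : proj G α β γ δ (σ (mk G α β γ δ (inW G (sndW G x)))) = 0 :=
    LinearMap.congr_fun hW (sndW G x)
  conv_lhs => rw [hx]
  rw [map_add, map_add, map_add, h2, add_zero]
  rfl

theorem induced_symm (u : S → ℚ) : induced σ.symm (induced σ u) = u := by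
  have h : u = proj G α β γ δ (mk G α β γ δ (inV G u)) := rfl
  conv_lhs => rw [h]
  rw [← proj_apply, ← proj_apply, LieEquiv.symm_apply_apply]
  rfl

theorem apply_brQ (u v : S → ℚ) :
    σ (brQ G α β γ δ u v) = brQ G α β γ δ (induced σ u) (induced σ v) := by
  rw [brQ_apply, LieEquiv.map_lie, lie_eq_brQ, proj_apply, proj_apply]
  rfl

/-- The automorphism of `V` induced by an automorphism. -/
noncomputable def inducedEquiv : (S → ℚ) ≃ₗ[ℚ] (S → ℚ) :=
  LinearEquiv.ofLinearMap (induced σ) (induced σ.symm)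
    (LinearMap.ext fun u => induced_symm σ.symm u) (LinearMap.ext fun u => induced_symm σ u)

/-- In the quotient the bracket of the images is zero, so upstairs it is a multiple of `X`; being a
single bracket, it is zero. -/
theorem br_induced_eq_zero (hdistinct : [α, β, γ, δ].Nodup) (hαβ : G.Adj α β)
    (hγδ : G.Adj γ δ) (hαγ : G.Adj α γ) (hαδ : G.Adj α δ) {u v : S → ℚ} (h : br G u v = 0) :
    br G (induced σ u) (induced σ v) = 0 := by
  have h1 : ofCoord G α β γ δ (br G (induced σ u) (induced σ v)) = 0 := by
    rw [ofCoord_br, ← apply_brQ, ← ofCoord_br, h, map_zero, map_zero]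
  obtain ⟨t, ht⟩ := ofCoord_eq_zero (br_mem_brSpan _ _) h1
  rw [ht, br_ne_smul_quotCoord hdistinct hαβ hγδ hαγ hαδ ht, zero_smul]

theorem br_inducedEquiv_eq_zero_iff (hdistinct : [α, β, γ, δ].Nodup) (hαβ : G.Adj α β)
    (hγδ : G.Adj γ δ) (hαγ : G.Adj α γ) (hαδ : G.Adj α δ) (u v : S → ℚ) :
    br G (inducedEquiv σ u) (inducedEquiv σ v) = 0 ↔ br G u v = 0 := by
  refine ⟨fun h => ?_, br_induced_eq_zero σ hdistinct hαβ hγδ hαγ hαδ⟩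
  have := br_induced_eq_zero σ.symm hdistinct hαβ hγδ hαγ hαδ h
  rwa [show inducedEquiv σ u = induced σ u from rfl, show inducedEquiv σ v = induced σ v from rfl,
    induced_symm, induced_symm] at this

end Automorphism

end QuotLie

end GraphLie

/-! ### Derivations and the final contradiction -/

namespace GraphLie

/-- Extending a triangular map to a derivation. -/
theorem exists_derivation {S : Type*} [Fintype S] [DecidableEq S] {G : SimpleGraph S}
    {M : (S → ℚ) →ₗ[ℚ] (S → ℚ)} (hM : IsTri G M) :
    ∃ D : (S → S → ℚ) →ₗ[ℚ] (S → S → ℚ), ∀ u v, D (br G u v) = br G (M u) v + br G u (M v) := by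
  refine ⟨liftBr ((br G).compl₁₂ M LinearMap.id + (br G).compl₁₂ LinearMap.id M),
    fun u v => (liftBr_br _ (fun a b => ?_) (fun a b hab => ?_) u v)⟩
  · simp only [LinearMap.add_apply, LinearMap.compl₁₂_apply, LinearMap.id_apply]
    rw [br_swap (Pi.single a 1) (M _), br_swap (M _) (Pi.single b 1)]
    abel
  · simp only [LinearMap.add_apply, LinearMap.compl₁₂_apply, LinearMap.id_apply]
    by_cases hne : a = b
    · subst hne
      rw [br_swap (M _) (Pi.single a 1)]
      abel
    · rw [hM.br_eq_zero hne hab, br_swap, hM.br_eq_zero (Ne.symm hne) fun h => hab h.symm]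
      simp

namespace QuotLie

theorem not_isHyperbolic {S : Type*} [Fintype S] [DecidableEq S] {G : SimpleGraph S}
    {α β γ δ : S} (hdistinct : [α, β, γ, δ].Nodup)
    (hαβ : G.Adj α β) (hγδ : G.Adj γ δ) (hαγ : G.Adj α γ) (hαδ : G.Adj α δ)
    (σ : QuotLie G α β γ δ ≃ₗ⁅ℚ⁆ QuotLie G α β γ δ)
    (hint : HasIntegralUnitCharpoly (σ : QuotLie G α β γ δ →ₗ[ℚ] QuotLie G α β γ δ)) :
    ¬ IsHyperbolic (σ : QuotLie G α β γ δ →ₗ[ℚ] QuotLie G α β γ δ) := by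
  intro hyp
  have hiff := br_inducedEquiv_eq_zero_iff σ hdistinct hαβ hγδ hαγ hαδ
  obtain ⟨k, hk, htri⟩ := exists_pow_isTri hiff
  set f : (S → ℚ) →ₗ[ℚ] (S → ℚ) := (inducedEquiv σ).toLinearMap
  set s := (σ : QuotLie G α β γ δ →ₗ[ℚ] QuotLie G α β γ δ)
  set M : (S → ℚ) →ₗ[ℚ] (S → ℚ) := f ^ k
  set X := quotCoord G α β γ δ with hX
  have hproj : ∀ n x, proj G α β γ δ ((s ^ n) x) = (f ^ n) (proj G α β γ δ x) := by
    intro n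
    induction n with
    | zero => intro x; rfl
    | succ n ih =>
      intro x
      rw [pow_succ, pow_succ, Module.End.mul_apply, Module.End.mul_apply, ih]
      exact congrArg _ (proj_apply σ x)
  have hbrQ : ∀ n u v, (s ^ n) (brQ G α β γ δ u v) = brQ G α β γ δ ((f ^ n) u) ((f ^ n) v) := by
    intro n
    induction n with
    | zero => intro u v; rfl
    | succ n ih =>
      intro u v
      rw [pow_succ, pow_succ, Module.End.mul_apply, Module.End.mul_apply, Module.End.mul_apply,
        ← ih]
      exact congrArg _ (apply_brQ σ u v)
  have hcomm : ∀ n u v, br G u v = 0 → br G ((f ^ n) u) ((f ^ n) v) = 0 := by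
    intro n
    induction n with
    | zero => intro u v h; exact h
    | succ n ih =>
      intro u v h
      rw [pow_succ, Module.End.mul_apply, Module.End.mul_apply]
      exact ih _ _ ((hiff u v).mpr h)
  obtain ⟨F, hFdef⟩ : ∃ F, F = liftBr ((br G).compl₁₂ M M) := ⟨_, rfl⟩
  have hF : ∀ u v, F (br G u v) = br G (M u) (M v) := by
    intro u v
    rw [hFdef, liftBr_br]
    · rfl
    · exact fun a b => br_swap _ _
    · exact fun a b hab => hcomm k _ _ (br_single_of_not_adj hab)
  have hFO : ∀ w, (s ^ k) (ofCoord G α β γ δ w) = ofCoord G α β γ δ (F w) := by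
    intro w
    rw [hFdef, ofCoord, liftBr_apply, liftBr_apply (B := (br G).compl₁₂ M M)]
    simp only [map_smul, map_sum]
    congr 1
    refine Finset.sum_congr rfl fun a _ => Finset.sum_congr rfl fun b _ => ?_
    rw [hbrQ, LinearMap.compl₁₂_apply]
    exact congrArg _ (ofCoord_br _ _).symm
  obtain ⟨D, hD⟩ := exists_derivation htri
  have hFX : F X = br G (M (Pi.single α 1)) (M (Pi.single β 1)) +
      br G (M (Pi.single γ 1)) (M (Pi.single δ 1)) := by
    rw [hX, quotCoord, map_add, hF, hF]
  have hDX : D X = br G (M (Pi.single α 1)) (Pi.single β 1) +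
      br G (Pi.single α 1) (M (Pi.single β 1)) + (br G (M (Pi.single γ 1)) (Pi.single δ 1) +
      br G (Pi.single γ 1) (M (Pi.single δ 1))) := by
    rw [hX, quotCoord, map_add, hD, hD]
  obtain ⟨c, hc⟩ : ∃ c : ℚ, F X = c • X := by
    refine ofCoord_eq_zero (hFX ▸ add_mem (br_mem_brSpan _ _) (br_mem_brSpan _ _)) ?_
    rw [← hFO, ofCoord_quotCoord, map_zero]
  -- `F` and `D` commute on brackets, since both come from `M`; hence `F (D X) = D (F X)`.
  have hFD : F (D X) = c • D X := by
    rw [← map_smul, ← hc, hFX, hDX]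
    simp only [map_add, hF, hD]
  obtain ⟨μ, hμ⟩ : ∃ μ : ℚ, D X = μ • X := by
    refine ofCoord_eq_zero (α := α) (β := β) (γ := γ) (δ := δ) ?_ ?_
    · rw [hDX]
      exact add_mem (add_mem (br_mem_brSpan _ _) (br_mem_brSpan _ _))
        (add_mem (br_mem_brSpan _ _) (br_mem_brSpan _ _))
    -- The zero subspace is used as `N`: the class of `D X` in the quotient algebra satisfies the
    -- eigenvector equation for the rational number `c`, so it vanishes.
    · refine (Submodule.mem_bot ℚ).mp (not_eigen_mod hyp hint hk (q := c) ?_ ?_)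
      · intro x hx
        rw [(Submodule.mem_bot ℚ).mp hx, map_zero]
        exact Submodule.zero_mem _
      · rw [hFO, hFD, map_smul, sub_self]
        exact Submodule.zero_mem _
  refine Config.elim (G := G) (M := M) (F := F) (α := α) (β := β) (γ := γ) (δ := δ) (p := 1)
    (q := 1) (c := c) (μ := μ) (X := X) ?_
  refine ⟨hdistinct, hαβ, hγδ, hαγ, hαδ, one_ne_zero, one_ne_zero, ?_, htri, hF, ?_, ?_, ?_, ?_⟩
  · rw [one_smul, one_smul, hX, quotCoord]
  · rw [one_smul, one_smul, ← hμ, hDX]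
  · rw [one_smul, one_smul, ← hc, hFX]
  · intro x r hx
    have hmem := not_eigen_mod hyp hint hk (q := r)
      (N := (ltSpace G x).comap (proj G α β γ δ)) (z := mk G α β γ δ (inV G (Pi.single x 1))) ?_ ?_
    · have hz : Pi.single x 1 ∈ ltSpace G x := hmem
      exact (hz x (by simp)).2 (Dom.refl x)
    · intro y hy
      rw [Submodule.mem_comap, hproj]
      exact htri.map_ltSpace hy
    · rw [Submodule.mem_comap, map_sub, map_smul, hproj]
      exact hx
  · intro x u v huv
    -- Working modulo the image of `lowBr` in the quotient algebra; lifting back to coordinates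
    -- costs a multiple of `X`, which is the `t` in the conclusion.
    have hmem := not_eigen_mod hyp hint hk (q := c)
      (N := (lowBr G x).map (ofCoord G α β γ δ)) (z := ofCoord G α β γ δ (br G u v)) ?_ ?_
    · obtain ⟨y, hy, hyz⟩ := hmem
      have hspan : lowBr G x ≤ brSpan G := Submodule.span_mono (by
        rintro _ ⟨u, _, v, _, rfl⟩
        exact ⟨u, v, rfl⟩)
      obtain ⟨t, ht⟩ := ofCoord_eq_zero (α := α) (β := β) (γ := γ) (δ := δ)
        (sub_mem (br_mem_brSpan u v) (hspan hy)) (by rw [map_sub, hyz, sub_self])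
      refine ⟨t, ?_⟩
      rw [hX, ← ht, sub_sub_cancel]
      exact hy
    · rintro _ ⟨y, hy, rfl⟩
      rw [hFO]
      refine Submodule.mem_map_of_mem ?_
      induction hy using Submodule.span_induction with
      | mem w hw =>
        obtain ⟨u, hu, v, hv, rfl⟩ := hw
        rw [hF]
        exact br_mem_lowBr (htri.map_leSpace hu) (htri.map_ltSpace hv)
      | zero => rw [map_zero]; exact Submodule.zero_mem _
      | add w₁ w₂ _ _ h₁ h₂ => rw [map_add]; exact add_mem h₁ h₂
      | smul t w _ h => rw [map_smul]; exact Submodule.smul_mem _ _ h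
    · rw [hFO, ← map_smul, ← map_sub]
      exact Submodule.mem_map_of_mem huv

end QuotLie

end GraphLie

theorem mainTheorem2 {S : Type*} [Fintype S] [DecidableEq S] (G : SimpleGraph S)
    (α β γ δ : S) (hdistinct : [α, β, γ, δ].Nodup)
    (hαβ : G.Adj α β) (hγδ : G.Adj γ δ) (hαγ : G.Adj α γ) (hαδ : G.Adj α δ) :
    ¬ ∃ σ : GraphLie.QuotLie G α β γ δ ≃ₗ⁅ℚ⁆ GraphLie.QuotLie G α β γ δ,
      GraphLie.IsHyperbolic (σ : GraphLie.QuotLie G α β γ δ →ₗ[ℚ] GraphLie.QuotLie G α β γ δ) ∧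
      GraphLie.HasIntegralUnitCharpoly
        (σ : GraphLie.QuotLie G α β γ δ →ₗ[ℚ] GraphLie.QuotLie G α β γ δ) := by
  rintro ⟨σ, hyp, hint⟩
  exact GraphLie.QuotLie.not_isHyperbolic hdistinct hαβ hγδ hαγ hαδ σ hint hyp
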